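/- All manifolds are smooth and finite-dimensional, all maps are smooth, and a *fibration* is a surjective submersion; for a fibration $\pi:P\to M$ put $T^\pi P=\ker(d\pi)$. A *Pfaffian fibration* $(P,\theta)$ over $M$ is a fibration $\pi:P\to M$ together with a pointwise surjective $1$-form $\theta\in\Omega^1(P,\mathcal N)$ with values in a vector bundle $\mathcal N\to P$ such that $T^\pi P+\ker\theta=TP$ and such that the *symbol space* $\mathfrak g(\theta):=T^\pi P\cap\ker\theta$ is an involutive distribution. Its *curvature* $\kappa_\theta:\ker\theta\times\ker\theta\to\mathcal N$ is the bilinear map given on local sections $U,V$ of $\ker\theta$ by $\kappa_\theta(U,V)=\theta([U,V])$. Its *symbol map* is $\partial:\mathfrak g(\theta)\to\mathrm{Hom}(\pi^*TM,\mathcal N)$, $\partial(v)(Y)=\kappa_\theta(v,\bar Y)$, where for $v\in\mathfrak g(\theta)_p$ and $Y\in T_{\pi(p)}M$ the vector $\bar Y\in\ker\theta_p$ is any vector with $d\pi(\bar Y)=Y$. For a fibration $\tau:Q\to M$, the first jet space is $J^1Q=\{(q,\zeta): q\in Q,\ \zeta:T_{\tau(q)}M\to T_qQ \text{ linear},\ d\tau\circ\zeta=\mathrm{id}\}$,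 an embedded submanifold of the total space of the vector bundle $\mathrm{Hom}(\tau^*TM,TQ)$, with projection $\mathrm{pr}(q,\zeta)=q$. Its Cartan form $\theta_{\mathrm{can}}\in\Omega^1(J^1Q,\mathrm{pr}^*T^\tau Q)$ is $(\theta_{\mathrm{can}})_{(q,\zeta)}(X)=d\,\mathrm{pr}(X)-\zeta\big(d(\tau\circ\mathrm{pr})(X)\big)$. **Statement.** Let $\pi:(P,\theta)\to M$ be a Pfaffian fibration with $\theta\in\Omega^1(P,\mathcal N)$, and assume that the foliation of $P$ defined by $\mathfrak g(\theta)$ is simple: there is a fibration $f:P\to Q$ with connected fibres such that $\mathfrak g(\theta)=\ker(df)$ (so the leaves are exactly the fibres of $f$). Then there exist - a fibration $\tau:Q\to M$ such that $\tau\circ f=\pi$; - a vector bundle isomorphism $\Phi:f^*(T^\tau Q)\to\mathcal N$ over $P$; - a unique smooth map $i:P\to J^1Q$ with $\mathrm{pr}\circ i=f$ (a bundle map) such that $\Phi\circ i^*\theta_{\mathrm{can}}=\theta$. If, moreover, the symbol map $\partial:\mathfrak g(\theta)\to\mathrm{Hom}(\pi^*TM,\mathcal N)$ is injective, then $i$ is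 an immersion. -/

import Mathlib

open Bundle Set
open scoped Manifold ContDiff Topology

noncomputable section

namespace Pfaffian

/-! Every manifold below is a smooth manifold without boundary, modelled on a normed space `E`
through `𝓘(ℝ, E)`; smooth means `C^∞`. -/

section Fibrations

variable {EP : Type*} [NormedAddCommGroup EP] [NormedSpace ℝ EP]
  {P : Type*} [TopologicalSpace P] [ChartedSpace EP P] [IsManifold 𝓘(ℝ, EP) ∞ P]
  {EM : Type*} [NormedAddCommGroup EM] [NormedSpace ℝ EM]
  {M : Type*} [TopologicalSpace M] [ChartedSpace EM M]

variable (EP EM) in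
/-- A fibration: a smooth surjective submersion. -/
structure IsFibration (ρ : P → M) : Prop where
  contMDiff : ContMDiff 𝓘(ℝ, EP) 𝓘(ℝ, EM) ∞ ρ
  surjective : Function.Surjective ρ
  submersion : ∀ p, Function.Surjective (mfderiv 𝓘(ℝ, EP) 𝓘(ℝ, EM) ρ p)

variable (EP EM) in
/-- The vertical space `T^ρ_p P = ker (d_p ρ)`. -/
def vertical (ρ : P → M) (p : P) : Submodule ℝ (TangentSpace 𝓘(ℝ, EP) p) :=
  LinearMap.ker (mfderiv 𝓘(ℝ, EP) 𝓘(ℝ, EM) ρ p).toLinearMap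

variable (EP EM) in
/-- The identification of the vertical spaces at two equal points. -/
def verticalCast (ρ : P → M) {p p' : P} (h : p = p') :
    vertical EP EM ρ p ≃ₗ[ℝ] vertical EP EM ρ p' := by
  subst h
  exact LinearEquiv.refl ℝ _

/-- `X` is smooth on the open set `U` (as a map into `TP`) and tangent there to the family `D` of
subspaces of the tangent spaces. -/
structure IsSmoothTangentOn (D : ∀ p : P, Submodule ℝ (TangentSpace 𝓘(ℝ, EP) p))
    (X : ∀ p : P, TangentSpace 𝓘(ℝ, EP) p) (U : Set P) : Prop where
  isOpen : IsOpen U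
  contMDiffOn : ContMDiffOn 𝓘(ℝ, EP) 𝓘(ℝ, EP).tangent ∞
    (fun p ↦ (⟨p, X p⟩ : TangentBundle 𝓘(ℝ, EP) P)) U
  mem : ∀ p ∈ U, X p ∈ D p

/-- Involutivity in the sense of Frobenius: the Lie bracket of any two (local) smooth vector fields
tangent to `D` is tangent to `D`. -/
def IsInvolutive (D : ∀ p : P, Submodule ℝ (TangentSpace 𝓘(ℝ, EP) p)) : Prop :=
  ∀ (U : Set P) (X Y : ∀ p : P, TangentSpace 𝓘(ℝ, EP) p),
    IsSmoothTangentOn D X U → IsSmoothTangentOn D Y U →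
      ∀ p ∈ U, VectorField.mlieBracket 𝓘(ℝ, EP) X Y p ∈ D p

end Fibrations

section Forms

variable {EP : Type*} [NormedAddCommGroup EP] [NormedSpace ℝ EP]
  {P : Type*} [TopologicalSpace P] [ChartedSpace EP P] [IsManifold 𝓘(ℝ, EP) ∞ P]
  {EM : Type*} [NormedAddCommGroup EM] [NormedSpace ℝ EM]
  {M : Type*} [TopologicalSpace M] [ChartedSpace EM M]
  {F : Type*} [NormedAddCommGroup F] [NormedSpace ℝ F]
  {N : P → Type*} [TopologicalSpace (TotalSpace F N)] [∀ p, AddCommGroup (N p)]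
  [∀ p, Module ℝ (N p)] [∀ p, TopologicalSpace (N p)]

/-- The kernel of an `N`-valued `1`-form. -/
def kernel (θ : ∀ p : P, TangentSpace 𝓘(ℝ, EP) p →L[ℝ] N p) (p : P) :
    Submodule ℝ (TangentSpace 𝓘(ℝ, EP) p) :=
  LinearMap.ker (θ p).toLinearMap

variable (EM) in
/-- The symbol space `𝔤(θ) = T^ρ P ∩ ker θ`. -/
def symbolSpace (ρ : P → M) (θ : ∀ p : P, TangentSpace 𝓘(ℝ, EP) p →L[ℝ] N p) (p : P) :
    Submodule ℝ (TangentSpace 𝓘(ℝ, EP) p) :=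
  vertical EP EM ρ p ⊓ kernel θ p

variable (EM F) in
/-- `(P, θ)` is a Pfaffian fibration over `M`, with projection `ρ` and with `θ ∈ Ω¹(P, N)`. -/
structure IsPfaffianFibration [∀ p, IsTopologicalAddGroup (N p)] [∀ p, ContinuousSMul ℝ (N p)]
    [FiberBundle F N] [VectorBundle ℝ F N]
    (ρ : P → M) (θ : ∀ p : P, TangentSpace 𝓘(ℝ, EP) p →L[ℝ] N p) : Prop where
  fibration : IsFibration EP EM ρ
  /-- `θ` is a smooth section of the bundle `Hom(TP, N)`. -/
  contMDiff : ContMDiff 𝓘(ℝ, EP) (𝓘(ℝ, EP).prod 𝓘(ℝ, EP →L[ℝ] F)) ∞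
    (fun p ↦ TotalSpace.mk' (EP →L[ℝ] F)
      (E := fun p : P ↦ TangentSpace 𝓘(ℝ, EP) p →L[ℝ] N p) p (θ p))
  surjective : ∀ p, Function.Surjective (θ p)
  regular : ∀ p, vertical EP EM ρ p ⊔ kernel θ p = ⊤
  involutive : IsInvolutive (symbolSpace EM ρ θ)

/-- `(X, Y)` is a pair of vector fields that are smooth near `p` and tangent to `ker θ` near `p`,
with values `u` and `v` at `p`. -/
def IsExtension (θ : ∀ p : P, TangentSpace 𝓘(ℝ, EP) p →L[ℝ] N p) (p : P)
    (u v : TangentSpace 𝓘(ℝ, EP) p)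
    (XY : (∀ x : P, TangentSpace 𝓘(ℝ, EP) x) × (∀ x : P, TangentSpace 𝓘(ℝ, EP) x)) : Prop :=
  XY.1 p = u ∧ XY.2 p = v ∧
    ∃ U : Set P, p ∈ U ∧ IsSmoothTangentOn (kernel θ) XY.1 U ∧ IsSmoothTangentOn (kernel θ) XY.2 U

open Classical in
/-- The curvature map `κ_θ : ker θ × ker θ → N`, `(X, Y) ↦ θ([X, Y])`. Its value at
`u, v ∈ ker θ_p` is computed with any extensions of `u`, `v` to local sections of `ker θ` (they exist
as soon as `θ` is smooth and pointwise surjective, and the value does not depend on them). -/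
def curvature (θ : ∀ p : P, TangentSpace 𝓘(ℝ, EP) p →L[ℝ] N p) (p : P) (u v : kernel θ p) : N p :=
  if h : ∃ XY, IsExtension θ p u v XY then
    θ p (VectorField.mlieBracket 𝓘(ℝ, EP) h.choose.1 h.choose.2 p)
  else 0

/-- By regularity, every vector of `T_{ρ p} M` is the projection of a vector of `ker θ_p`. -/
theorem exists_lift {ρ : P → M} {θ : ∀ p : P, TangentSpace 𝓘(ℝ, EP) p →L[ℝ] N p}
    [∀ p, IsTopologicalAddGroup (N p)] [∀ p, ContinuousSMul ℝ (N p)]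
    [FiberBundle F N] [VectorBundle ℝ F N]
    (h : IsPfaffianFibration EM F ρ θ) (p : P) (Y : TangentSpace 𝓘(ℝ, EM) (ρ p)) :
    ∃ w : kernel θ p, mfderiv 𝓘(ℝ, EP) 𝓘(ℝ, EM) ρ p w = Y := by
  obtain ⟨y, hy⟩ := h.fibration.submersion p Y
  have hmem : y ∈ vertical EP EM ρ p ⊔ kernel θ p := by rw [h.regular p]; trivial
  obtain ⟨a, ha, b, hb, hab⟩ := Submodule.mem_sup.1 hmem
  refine ⟨⟨b, hb⟩, ?_⟩
  have ha' : mfderiv 𝓘(ℝ, EP) 𝓘(ℝ, EM) ρ p a = 0 := ha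
  rw [← hy, ← hab, map_add, ha', zero_add]

/-- The symbol map `∂ : 𝔤(θ) → Hom(ρ^*TM, N)`, `∂(v)(Y) = κ_θ(v, Ȳ)`, where `Ȳ ∈ ker θ_p` is any
vector that projects to `Y` (the value does not depend on it). -/
def symbolMap {ρ : P → M} {θ : ∀ p : P, TangentSpace 𝓘(ℝ, EP) p →L[ℝ] N p}
    [∀ p, IsTopologicalAddGroup (N p)] [∀ p, ContinuousSMul ℝ (N p)]
    [FiberBundle F N] [VectorBundle ℝ F N]
    (h : IsPfaffianFibration EM F ρ θ) (p : P) (v : symbolSpace EM ρ θ p)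
    (Y : TangentSpace 𝓘(ℝ, EM) (ρ p)) : N p :=
  curvature θ p ⟨v, v.2.2⟩ (exists_lift h p Y).choose

end Forms

section Jets

variable {EM : Type*} [NormedAddCommGroup EM] [NormedSpace ℝ EM]
  {M : Type*} [TopologicalSpace M] [ChartedSpace EM M] [IsManifold 𝓘(ℝ, EM) ∞ M]
  {EQ : Type*} [NormedAddCommGroup EQ] [NormedSpace ℝ EQ]
  {Q : Type*} [TopologicalSpace Q] [ChartedSpace EQ Q] [IsManifold 𝓘(ℝ, EQ) ∞ Q]

/-- The fibre `T_{τ q} M` of `τ^*TM`, with its usual additive group structure. -/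
instance pullbackAddCommGroup (τ : C^∞⟮𝓘(ℝ, EQ), Q; 𝓘(ℝ, EM), M⟯) (q : Q) :
    AddCommGroup ((τ *ᵖ (fun x : M ↦ TangentSpace 𝓘(ℝ, EM) x)) q) :=
  inferInstanceAs (AddCommGroup (TangentSpace 𝓘(ℝ, EM) (τ q)))

/-- The total space of the smooth vector bundle `Hom(τ^*TM, TQ)` over `Q`. Its points are the pairs
`(q, ζ)` with `ζ : T_{τ q} M → T_q Q` linear. -/
abbrev HomBundle (τ : C^∞⟮𝓘(ℝ, EQ), Q; 𝓘(ℝ, EM), M⟯) : Type _ :=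
  TotalSpace (EM →L[ℝ] EQ)
    (fun q : Q ↦ (τ *ᵖ (fun x : M ↦ TangentSpace 𝓘(ℝ, EM) x)) q →L[ℝ] TangentSpace 𝓘(ℝ, EQ) q)

/-- The linear map `ζ : T_{τ q} M → T_q Q` of a point `(q, ζ)` of `Hom(τ^*TM, TQ)`. -/
def HomBundle.hom {τ : C^∞⟮𝓘(ℝ, EQ), Q; 𝓘(ℝ, EM), M⟯} (z : HomBundle τ) :
    TangentSpace 𝓘(ℝ, EM) (τ z.proj) →L[ℝ] TangentSpace 𝓘(ℝ, EQ) z.proj :=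
  z.snd

/-- The first jet space `J¹Q` of `τ : Q → M`: the pairs `(q, ζ)` with `ζ : T_{τ q} M → T_q Q` linear
and `dτ ∘ ζ = id`. It is an embedded submanifold of the total space of `Hom(τ^*TM, TQ)` (an affine
subbundle), so a map into it is smooth iff it is so as a map into `Hom(τ^*TM, TQ)`, and the
differential of such a map is the one computed there. -/
def Jet1 (τ : C^∞⟮𝓘(ℝ, EQ), Q; 𝓘(ℝ, EM), M⟯) : Type _ :=
  {z : HomBundle τ // ∀ v, mfderiv 𝓘(ℝ, EQ) 𝓘(ℝ, EM) τ z.proj (z.hom v) = v}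

/-- The model of the manifold `Hom(τ^*TM, TQ)`. -/
abbrev jetModel (EM EQ : Type*) [NormedAddCommGroup EM] [NormedSpace ℝ EM]
    [NormedAddCommGroup EQ] [NormedSpace ℝ EQ] :=
  𝓘(ℝ, EQ).prod 𝓘(ℝ, EM →L[ℝ] EQ)

variable {τ : C^∞⟮𝓘(ℝ, EQ), Q; 𝓘(ℝ, EM), M⟯}

/-- The expression `d pr (X) - ζ (dϖ (X))`, for `X` tangent to `Hom(τ^*TM, TQ)` at `(q, ζ)`, with
`pr` and `ϖ = τ ∘ pr` the projections to `Q` and to `M`. -/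
def cartanAux (z : HomBundle τ) :
    TangentSpace (jetModel EM EQ) z →L[ℝ] TangentSpace 𝓘(ℝ, EQ) z.proj :=
  mfderiv (jetModel EM EQ) 𝓘(ℝ, EQ) (fun y : HomBundle τ ↦ y.proj) z -
    z.hom.comp (mfderiv (jetModel EM EQ) 𝓘(ℝ, EM) (fun y : HomBundle τ ↦ τ y.proj) z)

theorem cartanAux_mem (z : Jet1 τ) (X : TangentSpace (jetModel EM EQ) z.1) :
    cartanAux z.1 X ∈ vertical EQ EM τ z.1.proj := by
  have h1 : MDifferentiableAt (jetModel EM EQ) 𝓘(ℝ, EQ) (fun y : HomBundle τ ↦ y.proj) z.1 :=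
    ((contMDiff_proj (IB := 𝓘(ℝ, EQ)) (n := ∞) (fun q : Q ↦
      (τ *ᵖ (fun x : M ↦ TangentSpace 𝓘(ℝ, EM) x)) q →L[ℝ] TangentSpace 𝓘(ℝ, EQ) q)) z.1
      ).mdifferentiableAt (by simp)
  have h2 : MDifferentiableAt 𝓘(ℝ, EQ) 𝓘(ℝ, EM) τ z.1.proj :=
    (τ.contMDiff z.1.proj).mdifferentiableAt (by simp)
  have h3 := mfderiv_comp (I := jetModel EM EQ) z.1 h2 h1
  have h4 := congrArg (fun L ↦ L X) h3
  change mfderiv 𝓘(ℝ, EQ) 𝓘(ℝ, EM) τ z.1.proj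
    (mfderiv (jetModel EM EQ) 𝓘(ℝ, EQ) (fun y : HomBundle τ ↦ y.proj) z.1 X -
      z.1.hom (mfderiv (jetModel EM EQ) 𝓘(ℝ, EM) (fun y : HomBundle τ ↦ τ y.proj) z.1 X)) = 0
  rw [map_sub, z.2]
  exact sub_eq_zero.2 h4.symm

/-- The Cartan form `θ_can ∈ Ω¹(J¹Q, pr^*T^τ Q)`: at `z = (q, ζ)` it maps `X` to
`d pr (X) - ζ (dϖ (X)) ∈ T^τ_q Q`. (It is given by this formula on all vectors of the ambient
manifold `Hom(τ^*TM, TQ)` at points of `J¹Q`; only those tangent to `J¹Q` matter.) -/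
def cartanForm (z : Jet1 τ) :
    TangentSpace (jetModel EM EQ) z.1 →ₗ[ℝ] vertical EQ EM τ z.1.proj :=
  LinearMap.codRestrict _ (cartanAux z.1).toLinearMap (cartanAux_mem z)

variable {EP : Type*} [NormedAddCommGroup EP] [NormedSpace ℝ EP]
  {P : Type*} [TopologicalSpace P] [ChartedSpace EP P]

/-- Smoothness of a map from a manifold `P` to `J¹Q`. -/
def Jet1.ContMDiffInto (EP : Type*) [NormedAddCommGroup EP] [NormedSpace ℝ EP]
    {P : Type*} [TopologicalSpace P] [ChartedSpace EP P] (i : P → Jet1 τ) : Prop :=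
  ContMDiff 𝓘(ℝ, EP) (jetModel EM EQ) ∞ (fun p ↦ (i p).1)

/-- The differential at `p` of a map from a manifold `P` to `J¹Q`. -/
def Jet1.differential (i : P → Jet1 τ) (p : P) :
    TangentSpace 𝓘(ℝ, EP) p →L[ℝ] TangentSpace (jetModel EM EQ) (i p).1 :=
  mfderiv 𝓘(ℝ, EP) (jetModel EM EQ) (fun x ↦ (i x).1) p

variable (EP) in
/-- A map from a manifold `P` to `J¹Q` is an immersion: it is smooth, with injective differentials. -/
def Jet1.IsImmersionInto (i : P → Jet1 τ) : Prop :=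
  Jet1.ContMDiffInto EP i ∧ ∀ p, Function.Injective (Jet1.differential (EP := EP) i p)

variable (EP) in
/-- A vector bundle isomorphism `Φ : f^*(T^τ Q) → N` over `P`: a linear isomorphism
`T^τ_{f p} Q → N_p` for each `p`, such that `Φ` and `Φ⁻¹` map smooth local sections to smooth local
sections. (A local section of `f^*(T^τ Q)` over `U` is a map `U → TQ` over `f` with vertical values;
`T^τ Q` is a vector subbundle of `TQ`.) -/
structure VerticalIso (F : Type*) [NormedAddCommGroup F] [NormedSpace ℝ F]
    (N : P → Type*) [TopologicalSpace (TotalSpace F N)] [∀ p, AddCommGroup (N p)]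
    [∀ p, Module ℝ (N p)] [∀ p, TopologicalSpace (N p)] [FiberBundle F N]
    (f : P → Q) (τ : C^∞⟮𝓘(ℝ, EQ), Q; 𝓘(ℝ, EM), M⟯) where
  equiv : ∀ p, vertical EQ EM τ (f p) ≃ₗ[ℝ] N p
  smooth_toFun : ∀ (U : Set P), IsOpen U → ∀ w : (∀ p, vertical EQ EM τ (f p)),
    ContMDiffOn 𝓘(ℝ, EP) 𝓘(ℝ, EQ).tangent ∞
      (fun p ↦ (⟨f p, (w p : TangentSpace 𝓘(ℝ, EQ) (f p))⟩ : TangentBundle 𝓘(ℝ, EQ) Q)) U →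
    ContMDiffOn 𝓘(ℝ, EP) (𝓘(ℝ, EP).prod 𝓘(ℝ, F)) ∞
      (fun p ↦ TotalSpace.mk' F (E := N) p (equiv p (w p))) U
  smooth_invFun : ∀ (U : Set P), IsOpen U → ∀ s : (∀ p, N p),
    ContMDiffOn 𝓘(ℝ, EP) (𝓘(ℝ, EP).prod 𝓘(ℝ, F)) ∞ (fun p ↦ TotalSpace.mk' F (E := N) p (s p)) U →
    ContMDiffOn 𝓘(ℝ, EP) 𝓘(ℝ, EQ).tangent ∞
      (fun p ↦ (⟨f p, ((equiv p).symm (s p) : TangentSpace 𝓘(ℝ, EQ) (f p))⟩ :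
        TangentBundle 𝓘(ℝ, EQ) Q)) U

/-- `i : P → J¹Q` is a smooth bundle map over `f` (that is, `pr ∘ i = f`) with
`Φ ∘ i^*θ_can = θ`. -/
structure IsCartanBundleMap {F : Type*} [NormedAddCommGroup F] [NormedSpace ℝ F]
    {N : P → Type*} [TopologicalSpace (TotalSpace F N)] [∀ p, AddCommGroup (N p)]
    [∀ p, Module ℝ (N p)] [∀ p, TopologicalSpace (N p)] [FiberBundle F N]
    {f : P → Q} (Φ : VerticalIso EP F N f τ)
    (θ : ∀ p : P, TangentSpace 𝓘(ℝ, EP) p →L[ℝ] N p) (i : P → Jet1 τ) : Prop where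
  contMDiff : Jet1.ContMDiffInto EP i
  proj_eq : ∀ p, (i p).1.proj = f p
  comp_pullback_cartan : ∀ (p : P) (v : TangentSpace 𝓘(ℝ, EP) p),
    Φ.equiv p (verticalCast EQ EM τ (proj_eq p) (cartanForm (i p) (Jet1.differential i p v))) =
      θ p v

end Jets

end Pfaffian

end

/-! Since `𝔤(θ) = ker df` lies in `ker dρ`, the map `ρ` is constant along the connected fibres of
`f` and descends to `τ`; local sections of `f` show that `τ` is smooth (`exists_factorization`).

The rest of the construction is linear algebra at each point `p`. On `ker dρ`, both `df` and `θ` are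
surjective, onto `T^τ Q` and `N`, with the same kernel `𝔤(θ)`; this gives `Φ` (`verticalEquiv`). On
`ker θ`, the map `dρ` is onto `TM` by regularity and its kernel is again `𝔤(θ) = ker df`, so `df = ζ
∘ dρ` there for a unique `ζ` (`jetHom`), and `i p = (f p, ζ)` (`jetMap`). If `v` differs from a
vertical vector `u` by an element of `ker θ`, then `df v - ζ (dρ v) = df u` and `θ v = θ u`, which
is `Φ ∘ i^*θ_can = θ`. Conversely this equation, read on `ker θ`, forces `ζ ∘ dρ = df` there, hence
uniqueness. Smoothness holds because, in trivializations, `Φ`, `Φ⁻¹` and `ζ` are composites of `df`,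
`θ` and smooth local right inverses of `df` and of `(dρ, θ)`.

For the immersion, suppose `di v = 0`. Then `df v = 0`, so `v ∈ 𝔤(θ)`, and the coordinate expression
`Z` of `ζ` has zero derivative along `v`. The distribution `ker θ` is cut out by `df = Z ∘ dρ`; for
sections `X`, `Y` of it, the failure of `[X, Y]` to satisfy this equation is `(dZ X)(dρ Y) - (dZ
Y)(dρ X)`. Both terms vanish when `X p = v`, so `κ_θ(v, ·) = 0` (`curvature_eq_zero`), i.e. `∂ v =
0`, and `v = 0` by injectivity of `∂`. -/

set_option linter.unusedSectionVars false

noncomputable section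

namespace Pfaffian

/-! ### Calculus in normed spaces: submersions, brackets, right inverses -/

section Calculus

variable {E : Type*} [NormedAddCommGroup E] [NormedSpace ℝ E]
  {G : Type*} [NormedAddCommGroup G] [NormedSpace ℝ G]
  {H : Type*} [NormedAddCommGroup H] [NormedSpace ℝ H]

/-- A smooth map with surjective derivative at `x₀` is, in a suitable smooth chart around `x₀`,
the first projection of a product. -/
theorem exists_straightening [FiniteDimensional ℝ E] [FiniteDimensional ℝ G] {g : E → G} {x₀ : E}
    (hg : ContDiffAt ℝ ∞ g x₀) (hsurj : Function.Surjective (fderiv ℝ g x₀)) :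
    ∃ Ψ : OpenPartialHomeomorph E (G × (fderiv ℝ g x₀).ker),
      x₀ ∈ Ψ.source ∧ (∀ x, (Ψ x).1 = g x) ∧ (Ψ x₀).2 = 0 ∧ ContDiffAt ℝ ∞ Ψ.symm (Ψ x₀) := by
  have := FiniteDimensional.complete ℝ E
  have := FiniteDimensional.complete ℝ G
  set L := fderiv ℝ g x₀
  obtain ⟨pr, hpr⟩ := L.ker_closedComplemented_of_finiteDimensional_range
  have hbij : Function.Bijective (L.prod pr) := by
    constructor
    · rw [injective_iff_map_eq_zero]
      intro x hx
      have h1 : L x = 0 := congrArg Prod.fst hx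
      have h2 : pr x = 0 := congrArg Prod.snd hx
      have h3 := hpr ⟨x, h1⟩
      rw [h2] at h3
      exact (congrArg Subtype.val h3).symm
    · rintro ⟨y, k⟩
      obtain ⟨x, rfl⟩ := hsurj y
      -- `x - pr x` lies in the kernel of `pr` and has the same image under `L` as `x`.
      refine ⟨x - pr x + k, ?_⟩
      have h1 : L (pr x : E) = 0 := (pr x).2
      have h2 : L (k : E) = 0 := k.2
      simp [h1, h2, hpr]
  set e : E ≃L[ℝ] G × L.ker := ContinuousLinearEquiv.ofBijective (L.prod pr)
    (LinearMap.ker_eq_bot.2 hbij.1) (LinearMap.range_eq_top.2 hbij.2)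
  -- The chart is `x ↦ (g x, pr (x - x₀))`; its derivative at `x₀` is `e`, so the inverse function
  -- theorem applies.
  have hsmooth : ContDiffAt ℝ ∞ (fun x ↦ (g x, pr (x - x₀))) x₀ :=
    hg.prodMk (pr.contDiff.contDiffAt.comp _ (contDiffAt_id.sub contDiffAt_const))
  have hderiv : HasFDerivAt (fun x ↦ (g x, pr (x - x₀))) (e : E →L[ℝ] G × L.ker) x₀ :=
    (hg.differentiableAt (by simp)).hasFDerivAt.prodMk
      (pr.hasFDerivAt.comp x₀ ((hasFDerivAt_id x₀).sub_const x₀))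
  refine ⟨hsmooth.toOpenPartialHomeomorph _ hderiv (by simp),
    hsmooth.mem_toOpenPartialHomeomorph_source hderiv (by simp), fun x ↦ rfl, ?_, ?_⟩
  · change pr (x₀ - x₀) = 0
    simp
  · exact hsmooth.to_localInverse hderiv (by simp)

/-- A smooth map `g` with surjective derivative at `x₀` has a smooth local section `s` through
`x₀`, and near `x₀` a map `r` with `ker dg ≤ ker dr` factors as `(r ∘ s) ∘ g`. -/
theorem exists_local_section_of_surjective [FiniteDimensional ℝ E] [FiniteDimensional ℝ G]
    {g : E → G} {r : E → H} {x₀ : E}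
    (hg : ContDiffAt ℝ ∞ g x₀) (hsurj : Function.Surjective (fderiv ℝ g x₀))
    (hgd : ∀ᶠ x in 𝓝 x₀, DifferentiableAt ℝ g x) (hrd : ∀ᶠ x in 𝓝 x₀, DifferentiableAt ℝ r x)
    (hker : ∀ᶠ x in 𝓝 x₀, ∀ v, fderiv ℝ g x v = 0 → fderiv ℝ r x v = 0) :
    ∃ s : G → E, ContDiffAt ℝ ∞ s (g x₀) ∧ s (g x₀) = x₀ ∧ (∀ᶠ y in 𝓝 (g x₀), g (s y) = y) ∧
      ∀ᶠ x in 𝓝 x₀, r x = r (s (g x)) := by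
  obtain ⟨Ψ, hx₀, hfst, hsnd, hsymm⟩ := exists_straightening hg hsurj
  have hΨx₀ : Ψ x₀ = (g x₀, 0) := Prod.ext (hfst x₀) hsnd
  have hinv : Ψ.symm (g x₀, 0) = x₀ := by rw [← hΨx₀, Ψ.left_inv hx₀]
  rw [hΨx₀] at hsymm
  have hincl : ContDiff ℝ ∞ (fun y : G ↦ (y, (0 : (fderiv ℝ g x₀).ker))) :=
    contDiff_id.prodMk contDiff_const
  refine ⟨fun y ↦ Ψ.symm (y, 0), hsymm.comp (g x₀) hincl.contDiffAt, hinv, ?_, ?_⟩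
  · have htarget : Ψ.target ∈ 𝓝 (g x₀, (0 : (fderiv ℝ g x₀).ker)) := by
      rw [← hΨx₀]; exact Ψ.open_target.mem_nhds (Ψ.map_source hx₀)
    filter_upwards [hincl.continuous.continuousAt htarget] with y hy
    rw [← hfst, Ψ.right_inv hy]
  · have hdsymm : ∀ᶠ z in 𝓝 (g x₀, (0 : (fderiv ℝ g x₀).ker)), DifferentiableAt ℝ Ψ.symm z :=
      ((hsymm.of_le (m := 1) (by simp)).eventually (by simp)).mono
        fun z hz ↦ hz.differentiableAt (by simp)
    have htend : Filter.Tendsto Ψ.symm (𝓝 (g x₀, 0)) (𝓝 x₀) := by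
      have := hsymm.continuousAt
      rwa [ContinuousAt, hinv] at this
    have htarget : ∀ᶠ z in 𝓝 (g x₀, (0 : (fderiv ℝ g x₀).ker)), z ∈ Ψ.target := by
      rw [← hΨx₀]; exact Ψ.open_target.mem_nhds (Ψ.map_source hx₀)
    -- A ball in the sup norm is a product of balls, so its slices over points of `G` are convex,
    -- and a function with zero derivative on a slice is constant there.
    obtain ⟨δ, hδ, hball⟩ := Metric.eventually_nhds_iff_ball.1
      ((((htend.eventually hgd).and (htend.eventually hrd)).and (htend.eventually hker)).and
        (hdsymm.and htarget))
    have hnear : ∀ᶠ x in 𝓝 x₀, Ψ x ∈ Metric.ball (g x₀, (0 : (fderiv ℝ g x₀).ker)) δ := by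
      have := Ψ.continuousAt hx₀
      rw [ContinuousAt, hΨx₀] at this
      exact this (Metric.ball_mem_nhds _ hδ)
    filter_upwards [hnear, Ψ.open_source.mem_nhds hx₀] with x hx hxs
    rw [← ball_prod_same] at hball hx
    have hconst : ∀ k ∈ Metric.ball (0 : (fderiv ℝ g x₀).ker) δ,
        r (Ψ.symm (g x, k)) = r (Ψ.symm (g x, 0)) := by
      have hmem : ∀ k ∈ Metric.ball (0 : (fderiv ℝ g x₀).ker) δ,
          ((g x, k) : G × (fderiv ℝ g x₀).ker) ∈ Metric.ball (g x₀) δ ×ˢ Metric.ball 0 δ :=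
        fun k hk ↦ ⟨by simpa [hfst] using hx.1, hk⟩
      have hd : ∀ k ∈ Metric.ball (0 : (fderiv ℝ g x₀).ker) δ,
          HasFDerivAt (fun k ↦ r (Ψ.symm (g x, k))) (0 : (fderiv ℝ g x₀).ker →L[ℝ] H) k := by
        intro k hk
        obtain ⟨⟨⟨h1, h2⟩, h3⟩, h4, h5⟩ := hball _ (hmem k hk)
        have hc : HasFDerivAt (fun k : (fderiv ℝ g x₀).ker ↦ Ψ.symm (g x, k))
            ((fderiv ℝ Ψ.symm (g x, k)).comp (ContinuousLinearMap.inr ℝ G _)) k :=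
          h4.hasFDerivAt.comp k (hasFDerivAt_prodMk_right (g x) k)
        have hgc := h1.hasFDerivAt.comp k hc
        have hopen : ∀ᶠ k' in 𝓝 k, g (Ψ.symm (g x, k')) = g x := by
          filter_upwards [Metric.isOpen_ball.mem_nhds hk] with k' hk'
          rw [← hfst, Ψ.right_inv (hball _ (hmem k' hk')).2.2]
        -- Along the slice `g ∘ Ψ.symm` is constant, so directions of the slice lie in `ker dg`,
        -- hence in `ker dr`.
        have hzero := hgc.unique ((hasFDerivAt_const (g x) k).congr_of_eventuallyEq hopen)
        refine (h2.hasFDerivAt.comp k hc).congr_fderiv ?_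
        ext v
        exact h3 _ (congrArg (fun T : (fderiv ℝ g x₀).ker →L[ℝ] G ↦ T v) hzero)
      intro k hk
      refine (convex_ball (0 : (fderiv ℝ g x₀).ker) δ).is_const_of_fderivWithin_eq_zero (𝕜 := ℝ)
        (fun k hk ↦ (hd k hk).differentiableAt.differentiableWithinAt) (fun k hk ↦ ?_) hk
        (Metric.mem_ball_self hδ)
      rw [fderivWithin_of_isOpen Metric.isOpen_ball hk, (hd k hk).fderiv]
    rw [← hconst _ hx.2, ← hfst x, Ψ.left_inv hxs]

/-- The Lie bracket acts on functions as a commutator of derivations. -/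
theorem fderiv_lieBracket_apply {g : E → G} {V W : E → E} {x : E} (hg : ContDiffAt ℝ 2 g x)
    (hV : DifferentiableAt ℝ V x) (hW : DifferentiableAt ℝ W x) :
    fderiv ℝ g x (VectorField.lieBracket ℝ V W x) =
      fderiv ℝ (fun y ↦ fderiv ℝ g y (W y)) x (V x) -
        fderiv ℝ (fun y ↦ fderiv ℝ g y (V y)) x (W x) := by
  have hd : DifferentiableAt ℝ (fderiv ℝ g) x :=
    (hg.fderiv_right (m := 1) (by norm_num)).differentiableAt (by simp)
  have hsymm : IsSymmSndFDerivAt ℝ g x := hg.isSymmSndFDerivAt (by simp)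
  -- Each term contributes a second derivative of `g` on `V x`, `W x`; these cancel by symmetry.
  rw [fderiv_clm_apply hd hW, fderiv_clm_apply hd hV, VectorField.lieBracket_eq]
  have := hsymm.eq (V x) (W x)
  simp [this]

/-- A smooth family of linear maps that is surjective at `p₀` has a smooth family of right inverses
near `p₀`. -/
theorem exists_smooth_rightInverse [FiniteDimensional ℝ G] {EP : Type*} [NormedAddCommGroup EP]
    [NormedSpace ℝ EP] {P : Type*} [TopologicalSpace P] [ChartedSpace EP P] {p₀ : P}
    {A : P → E →L[ℝ] G} (hA : ContMDiffAt 𝓘(ℝ, EP) 𝓘(ℝ, E →L[ℝ] G) ∞ A p₀)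
    (hsurj : Function.Surjective (A p₀)) :
    ∃ B : P → G →L[ℝ] E, ContMDiffAt 𝓘(ℝ, EP) 𝓘(ℝ, G →L[ℝ] E) ∞ B p₀ ∧
      ∀ᶠ p in 𝓝 p₀, ∀ y, A p (B p y) = y := by
  have := FiniteDimensional.complete ℝ G
  -- For a fixed right inverse `R` of `A p₀`, the endomorphism `A p ∘ R` is the identity at `p₀`,
  -- hence invertible nearby, and `R ∘ (A p ∘ R)⁻¹` is the required right inverse.
  obtain ⟨R, hR⟩ := (A p₀).exists_rightInverse_of_surjective (LinearMap.range_eq_top.2 hsurj)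
  have hC : ContMDiffAt 𝓘(ℝ, EP) 𝓘(ℝ, G →L[ℝ] G) ∞ (fun p ↦ (A p).comp R) p₀ :=
    hA.clm_comp contMDiffAt_const
  have hunit : (A p₀).comp R = ((1 : (G →L[ℝ] G)ˣ) : G →L[ℝ] G) := hR
  have hinv : ContMDiffAt 𝓘(ℝ, EP) 𝓘(ℝ, G →L[ℝ] G) ∞ (fun p ↦ Ring.inverse ((A p).comp R)) p₀ :=
    ContMDiffAt.comp (I' := 𝓘(ℝ, G →L[ℝ] G)) (g := Ring.inverse) p₀
      (by rw [hunit]; exact (contDiffAt_ringInverse ℝ 1).contMDiffAt) hC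
  refine ⟨fun p ↦ R.comp (Ring.inverse ((A p).comp R)), contMDiffAt_const.clm_comp hinv, ?_⟩
  have hev : ∀ᶠ p in 𝓝 p₀, IsUnit ((A p).comp R) :=
    hC.continuousAt (Units.isOpen.mem_nhds (hunit ▸ Units.isUnit 1))
  filter_upwards [hev] with p hp y
  exact congrArg (fun T : G →L[ℝ] G ↦ T y) (Ring.mul_inverse_cancel _ hp)

end Calculus

/-! ### Submersions of manifolds: local sections and descent -/

section Charts

variable {EP : Type*} [NormedAddCommGroup EP] [NormedSpace ℝ EP]
  {P : Type*} [TopologicalSpace P] [ChartedSpace EP P] [IsManifold 𝓘(ℝ, EP) ∞ P]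
  {EM : Type*} [NormedAddCommGroup EM] [NormedSpace ℝ EM]
  {M : Type*} [TopologicalSpace M] [ChartedSpace EM M] [IsManifold 𝓘(ℝ, EM) ∞ M]
  {EQ : Type*} [NormedAddCommGroup EQ] [NormedSpace ℝ EQ]
  {Q : Type*} [TopologicalSpace Q] [ChartedSpace EQ Q] [IsManifold 𝓘(ℝ, EQ) ∞ Q]

theorem mdifferentiableAt_extChartAt_symm (p₀ : P) {x : EP}
    (hx : x ∈ (extChartAt 𝓘(ℝ, EP) p₀).target) :
    MDifferentiableAt 𝓘(ℝ, EP) 𝓘(ℝ, EP) (extChartAt 𝓘(ℝ, EP) p₀).symm x := by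
  have := mdifferentiableWithinAt_extChartAt_symm (I := 𝓘(ℝ, EP)) hx
  rwa [modelWithCornersSelf_coe, range_id, mdifferentiableWithinAt_univ] at this

theorem isInvertible_mfderiv_extChartAt_symm (p₀ : P) {x : EP}
    (hx : x ∈ (extChartAt 𝓘(ℝ, EP) p₀).target) :
    (mfderiv 𝓘(ℝ, EP) 𝓘(ℝ, EP) (extChartAt 𝓘(ℝ, EP) p₀).symm x).IsInvertible := by
  have := isInvertible_mfderivWithin_extChartAt_symm (I := 𝓘(ℝ, EP)) hx
  rwa [modelWithCornersSelf_coe, range_id, mfderivWithin_univ] at this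

/-- The differential of the coordinate expression of a map into a normed space. -/
theorem fderiv_comp_extChartAt_symm {h : P → EQ} (p₀ : P) {x : EP}
    (hx : x ∈ (extChartAt 𝓘(ℝ, EP) p₀).target)
    (hh : MDifferentiableAt 𝓘(ℝ, EP) 𝓘(ℝ, EQ) h ((extChartAt 𝓘(ℝ, EP) p₀).symm x)) :
    DifferentiableAt ℝ (h ∘ (extChartAt 𝓘(ℝ, EP) p₀).symm) x ∧
      ∀ v : EP, fderiv ℝ (h ∘ (extChartAt 𝓘(ℝ, EP) p₀).symm) x v =
        mfderiv 𝓘(ℝ, EP) 𝓘(ℝ, EQ) h ((extChartAt 𝓘(ℝ, EP) p₀).symm x)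
          (mfderiv 𝓘(ℝ, EP) 𝓘(ℝ, EP) (extChartAt 𝓘(ℝ, EP) p₀).symm x v) := by
  have hs := mdifferentiableAt_extChartAt_symm p₀ hx
  refine ⟨(hh.comp x hs).differentiableAt, fun v ↦ ?_⟩
  rw [← mfderiv_eq_fderiv, mfderiv_comp x hh hs]
  rfl

theorem mfderiv_extChartAt_comp {f : P → Q} {q₀ : Q} {p : P}
    (hp : f p ∈ (extChartAt 𝓘(ℝ, EQ) q₀).source)
    (hf : MDifferentiableAt 𝓘(ℝ, EP) 𝓘(ℝ, EQ) f p) :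
    mfderiv 𝓘(ℝ, EP) 𝓘(ℝ, EQ) (extChartAt 𝓘(ℝ, EQ) q₀ ∘ f) p =
      (mfderiv 𝓘(ℝ, EQ) 𝓘(ℝ, EQ) (extChartAt 𝓘(ℝ, EQ) q₀) (f p)).comp
        (mfderiv 𝓘(ℝ, EP) 𝓘(ℝ, EQ) f p) :=
  mfderiv_comp p (mdifferentiableAt_extChartAt (by simpa using hp)) hf

theorem contMDiffAt_extChartAt_comp {f : P → Q} {q₀ : Q} {p : P}
    (hp : f p ∈ (extChartAt 𝓘(ℝ, EQ) q₀).source) (hf : ContMDiffAt 𝓘(ℝ, EP) 𝓘(ℝ, EQ) ∞ f p) :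
    ContMDiffAt 𝓘(ℝ, EP) 𝓘(ℝ, EQ) ∞ (extChartAt 𝓘(ℝ, EQ) q₀ ∘ f) p :=
  (contMDiffAt_extChartAt' (by simpa using hp)).comp p hf

theorem contDiffAt_comp_extChartAt_symm {h : P → EQ} (p₀ : P)
    (hh : ContMDiffAt 𝓘(ℝ, EP) 𝓘(ℝ, EQ) ∞ h p₀) :
    ContDiffAt ℝ ∞ (h ∘ (extChartAt 𝓘(ℝ, EP) p₀).symm) (extChartAt 𝓘(ℝ, EP) p₀ p₀) := by
  rw [← contMDiffAt_iff_contDiffAt]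
  refine ContMDiffAt.comp (I' := 𝓘(ℝ, EP)) _ (by rwa [extChartAt_to_inv]) ?_
  exact (contMDiffOn_extChartAt_symm p₀).contMDiffAt (extChartAt_target_mem_nhds p₀)

/-- A submersion `f` has a smooth local section `s` through every point, and near that point a map
`ρ` with `ker df ≤ ker dρ` factors as `(ρ ∘ s) ∘ f`. -/
theorem exists_local_section [FiniteDimensional ℝ EP] [FiniteDimensional ℝ EQ]
    {f : P → Q} {ρ : P → M} (hf : IsFibration EP EQ f)
    (hρ : ContMDiff 𝓘(ℝ, EP) 𝓘(ℝ, EM) ∞ ρ)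
    (hker : ∀ p, vertical EP EQ f p ≤ vertical EP EM ρ p) (p₀ : P) :
    ∃ s : Q → P, ContMDiffAt 𝓘(ℝ, EQ) 𝓘(ℝ, EP) ∞ s (f p₀) ∧ s (f p₀) = p₀ ∧
      (∀ᶠ q in 𝓝 (f p₀), f (s q) = q) ∧ ∀ᶠ p in 𝓝 p₀, ρ p = ρ (s (f p)) := by
  set φ := extChartAt 𝓘(ℝ, EP) p₀
  set ψ := extChartAt 𝓘(ℝ, EQ) (f p₀)
  set χ := extChartAt 𝓘(ℝ, EM) (ρ p₀)
  have hsymm₀ : φ.symm (φ p₀) = p₀ := extChartAt_to_inv p₀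
  have hφ : ContinuousAt φ.symm (φ p₀) := continuousAt_extChartAt_symm p₀
  have hφt : Filter.Tendsto φ.symm (𝓝 (φ p₀)) (𝓝 p₀) := by rwa [ContinuousAt, hsymm₀] at hφ
  have hfsrc : ∀ᶠ p in 𝓝 p₀, f p ∈ ψ.source :=
    hf.contMDiff.continuous.continuousAt (extChartAt_source_mem_nhds (f p₀))
  have hρsrc : ∀ᶠ p in 𝓝 p₀, ρ p ∈ χ.source :=
    hρ.continuous.continuousAt (extChartAt_source_mem_nhds (ρ p₀))
  have hfd : ∀ p, MDifferentiableAt 𝓘(ℝ, EP) 𝓘(ℝ, EQ) f p :=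
    fun p ↦ (hf.contMDiff p).mdifferentiableAt (by simp)
  have hρd : ∀ p, MDifferentiableAt 𝓘(ℝ, EP) 𝓘(ℝ, EM) ρ p :=
    fun p ↦ (hρ p).mdifferentiableAt (by simp)
  have hg : ContDiffAt ℝ ∞ ((ψ ∘ f) ∘ φ.symm) (φ p₀) := contDiffAt_comp_extChartAt_symm p₀
    (contMDiffAt_extChartAt_comp hfsrc.self_of_nhds (hf.contMDiff p₀))
  have hgderiv : ∀ x ∈ φ.target, f (φ.symm x) ∈ ψ.source →
      DifferentiableAt ℝ ((ψ ∘ f) ∘ φ.symm) x ∧ ∀ v : EP, fderiv ℝ ((ψ ∘ f) ∘ φ.symm) x v =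
        mfderiv 𝓘(ℝ, EQ) 𝓘(ℝ, EQ) ψ (f (φ.symm x)) (mfderiv 𝓘(ℝ, EP) 𝓘(ℝ, EQ) f (φ.symm x)
          (mfderiv 𝓘(ℝ, EP) 𝓘(ℝ, EP) φ.symm x v)) := by
    intro x hx hfx
    have h := fderiv_comp_extChartAt_symm p₀ hx
      ((contMDiffAt_extChartAt_comp hfx (hf.contMDiff _)).mdifferentiableAt (by simp))
    rwa [mfderiv_extChartAt_comp hfx (hfd _)] at h
  have hrderiv : ∀ x ∈ φ.target, ρ (φ.symm x) ∈ χ.source →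
      DifferentiableAt ℝ ((χ ∘ ρ) ∘ φ.symm) x ∧ ∀ v : EP, fderiv ℝ ((χ ∘ ρ) ∘ φ.symm) x v =
        mfderiv 𝓘(ℝ, EM) 𝓘(ℝ, EM) χ (ρ (φ.symm x)) (mfderiv 𝓘(ℝ, EP) 𝓘(ℝ, EM) ρ (φ.symm x)
          (mfderiv 𝓘(ℝ, EP) 𝓘(ℝ, EP) φ.symm x v)) := by
    intro x hx hfx
    have h := fderiv_comp_extChartAt_symm p₀ hx
      ((contMDiffAt_extChartAt_comp hfx (hρ _)).mdifferentiableAt (by simp))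
    rwa [mfderiv_extChartAt_comp hfx (hρd _)] at h
  have htgt : ∀ᶠ x in 𝓝 (φ p₀), x ∈ φ.target := extChartAt_target_mem_nhds p₀
  have hsurj : Function.Surjective (fderiv ℝ ((ψ ∘ f) ∘ φ.symm) (φ p₀)) := by
    have hmem : f (φ.symm (φ p₀)) ∈ ψ.source := by rw [hsymm₀]; exact hfsrc.self_of_nhds
    rw [funext (hgderiv _ htgt.self_of_nhds hmem).2]
    exact ((isInvertible_mfderiv_extChartAt hmem).bijective.surjective.comp
      (hf.submersion _)).comp
        (isInvertible_mfderiv_extChartAt_symm p₀ htgt.self_of_nhds).bijective.surjective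
  obtain ⟨s, hs, hs₀, hgs, hrs⟩ := exists_local_section_of_surjective
    (r := (χ ∘ ρ) ∘ φ.symm) hg hsurj
    (by filter_upwards [htgt, hφt.eventually hfsrc] with x h1 h2
        exact (hgderiv x h1 h2).1)
    (by filter_upwards [htgt, hφt.eventually hρsrc] with x h1 h2
        exact (hrderiv x h1 h2).1)
    -- Differentials of charts are invertible, so the inclusion of kernels passes to coordinates.
    (by filter_upwards [htgt, hφt.eventually hfsrc, hφt.eventually hρsrc] with x h1 h2 h3 v hv
        rw [(hgderiv x h1 h2).2] at hv
        rw [(hrderiv x h1 h3).2]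
        have hv' : mfderiv 𝓘(ℝ, EP) 𝓘(ℝ, EQ) f (φ.symm x)
            (mfderiv 𝓘(ℝ, EP) 𝓘(ℝ, EP) φ.symm x v) = 0 :=
          (isInvertible_mfderiv_extChartAt h2).bijective.injective (hv.trans (map_zero _).symm)
        have hv'' : mfderiv 𝓘(ℝ, EP) 𝓘(ℝ, EM) ρ (φ.symm x)
            (mfderiv 𝓘(ℝ, EP) 𝓘(ℝ, EP) φ.symm x v) = 0 := hker _ hv'
        exact (congrArg (mfderiv 𝓘(ℝ, EM) 𝓘(ℝ, EM) χ (ρ (φ.symm x))) hv'').trans (map_zero _))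
  have hg₀ : ((ψ ∘ f) ∘ φ.symm) (φ p₀) = ψ (f p₀) := by simp [hsymm₀]
  rw [hg₀] at hs hs₀ hgs
  have hψ : ContMDiffAt 𝓘(ℝ, EQ) 𝓘(ℝ, EQ) ∞ ψ (f p₀) := contMDiffAt_extChartAt
  have hst : Filter.Tendsto (fun q ↦ s (ψ q)) (𝓝 (f p₀)) (𝓝 (φ p₀)) := by
    have := hs.continuousAt.comp hψ.continuousAt
    rwa [ContinuousAt, Function.comp_apply, hs₀] at this
  have hst' : Filter.Tendsto (fun q ↦ φ.symm (s (ψ q))) (𝓝 (f p₀)) (𝓝 p₀) := hφt.comp hst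
  refine ⟨fun q ↦ φ.symm (s (ψ q)), ?_, by simp [hs₀, hsymm₀], ?_, ?_⟩
  · have h1 : ContMDiffAt 𝓘(ℝ, EP) 𝓘(ℝ, EP) ∞ φ.symm (s (ψ (f p₀))) := by
      rw [hs₀]
      exact (contMDiffOn_extChartAt_symm p₀).contMDiffAt (extChartAt_target_mem_nhds p₀)
    exact h1.comp (f p₀) (hs.contMDiffAt.comp (f p₀) hψ)
  · filter_upwards [hψ.continuousAt.eventually hgs, hst'.eventually hfsrc,
      extChartAt_source_mem_nhds (I := 𝓘(ℝ, EQ)) (f p₀)] with q h1 h2 h3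
    exact ψ.injOn h2 h3 h1
  · have hφc : ContinuousAt φ p₀ := continuousAt_extChartAt p₀
    have hfc : ContinuousAt f p₀ := hf.contMDiff.continuous.continuousAt
    filter_upwards [hφc.eventually hrs, hρsrc, (hst'.comp hfc).eventually hρsrc,
      extChartAt_source_mem_nhds (I := 𝓘(ℝ, EP)) p₀] with p h1 h2 h3 h4
    simp only [Function.comp_apply, φ.left_inv h4] at h1
    exact χ.injOn h2 h3 h1

/-- A map whose differential vanishes along the connected fibres of a fibration `f` descends along
`f`. -/
theorem exists_factorization [FiniteDimensional ℝ EP] [FiniteDimensional ℝ EQ]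
    {f : P → Q} {ρ : P → M} (hf : IsFibration EP EQ f) (hconn : ∀ q, IsConnected (f ⁻¹' {q}))
    (hρ : ContMDiff 𝓘(ℝ, EP) 𝓘(ℝ, EM) ∞ ρ)
    (hker : ∀ p, vertical EP EQ f p ≤ vertical EP EM ρ p) :
    ∃ τ : C^∞⟮𝓘(ℝ, EQ), Q; 𝓘(ℝ, EM), M⟯, ∀ p, τ (f p) = ρ p := by
  have hconst : ∀ p p', f p = f p' → ρ p = ρ p' := by
    intro p p' hpp'
    have hpre : PreconnectedSpace (f ⁻¹' {f p'}) :=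
      isPreconnected_iff_preconnectedSpace.1 (hconn _).isPreconnected
    -- Near `x` one has `ρ = (ρ ∘ s) ∘ f`, and `f` is constant on the fibre.
    have hloc : IsLocallyConstant (fun x : f ⁻¹' {f p'} ↦ ρ x) := by
      rw [IsLocallyConstant.iff_eventually_eq]
      rintro ⟨x, hx⟩
      obtain ⟨s, -, hs₀, -, hs⟩ := exists_local_section hf hρ hker x
      filter_upwards [continuous_subtype_val.continuousAt.eventually hs] with y hy
      rw [hy, y.2, ← mem_singleton_iff.1 hx, hs₀]
    exact hloc.apply_eq_of_preconnectedSpace ⟨p, hpp'⟩ ⟨p', rfl⟩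
  set σ := Function.surjInv hf.surjective
  have hσ : ∀ p, ρ (σ (f p)) = ρ p := fun p ↦ hconst _ _ (Function.surjInv_eq hf.surjective _)
  refine ⟨⟨fun q ↦ ρ (σ q), fun q ↦ ?_⟩, hσ⟩
  obtain ⟨p, rfl⟩ := hf.surjective q
  -- The set-theoretic section `σ` may be discontinuous, but `ρ ∘ σ` agrees near `f p` with `ρ ∘ s`
  -- for a smooth local section `s`.
  obtain ⟨s, hs, hs₀, hfs, -⟩ := exists_local_section hf hρ hker p
  refine ((hρ (s (f p))).comp (f p) hs).congr_of_eventuallyEq ?_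
  filter_upwards [hfs] with q hq
  rw [Function.comp_apply, ← hσ (s q), hq]

/-- If `τ ∘ f` and `f` are fibrations then so is `τ`. -/
theorem IsFibration.of_comp {f : P → Q} (hf : IsFibration EP EQ f)
    {τ : C^∞⟮𝓘(ℝ, EQ), Q; 𝓘(ℝ, EM), M⟯} (h : IsFibration EP EM (τ ∘ f)) :
    IsFibration EQ EM τ where
  contMDiff := τ.contMDiff
  surjective := h.surjective.of_comp
  submersion q := by
    obtain ⟨p, rfl⟩ := hf.surjective q
    have := h.submersion p
    rw [mfderiv_comp p ((τ.contMDiff (f p)).mdifferentiableAt (by simp))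
      ((hf.contMDiff p).mdifferentiableAt (by simp))] at this
    exact Function.Surjective.of_comp this

end Charts

/-! ### Factoring linear maps through surjections -/

section LinearAlgebra

variable {V W X : Type*} [AddCommGroup V] [Module ℝ V] [AddCommGroup W] [Module ℝ W]
  [AddCommGroup X] [Module ℝ X]

/-- Two surjective linear maps with the same kernel have isomorphic targets. -/
theorem exists_linearEquiv_of_ker_eq (A : V →ₗ[ℝ] W) (C : V →ₗ[ℝ] X)
    (hA : Function.Surjective A) (hC : Function.Surjective C)
    (h : LinearMap.ker A = LinearMap.ker C) : ∃ e : W ≃ₗ[ℝ] X, ∀ v, e (A v) = C v := by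
  refine ⟨((A.quotKerEquivOfSurjective hA).symm.trans (Submodule.quotEquivOfEq _ _ h)).trans
    (C.quotKerEquivOfSurjective hC), fun v ↦ ?_⟩
  have : (A.quotKerEquivOfSurjective hA).symm (A v) = Submodule.Quotient.mk v :=
    (LinearEquiv.symm_apply_eq _).2 rfl
  simp [this]

/-- A linear map factors through a surjective one with smaller kernel. -/
theorem exists_linearMap_of_ker_le (A : V →ₗ[ℝ] W) (C : V →ₗ[ℝ] X)
    (hA : Function.Surjective A) (h : ∀ v, A v = 0 → C v = 0) :
    ∃ T : W →ₗ[ℝ] X, ∀ v, T (A v) = C v := by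
  obtain ⟨R, hR⟩ := A.exists_rightInverse_of_surjective (LinearMap.range_eq_top.2 hA)
  refine ⟨C ∘ₗ R, fun v ↦ ?_⟩
  have h1 : A (R (A v) - v) = 0 := by
    rw [map_sub, sub_eq_zero]; exact LinearMap.congr_fun hR (A v)
  have h2 := h _ h1
  rw [map_sub, sub_eq_zero] at h2
  exact h2

end LinearAlgebra

/-! ### Pointwise construction of `Φ` and `ζ` -/

section Pointwise

variable {EP : Type*} [NormedAddCommGroup EP] [NormedSpace ℝ EP]
  {P : Type*} [TopologicalSpace P] [ChartedSpace EP P] [IsManifold 𝓘(ℝ, EP) ∞ P]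
  {EM : Type*} [NormedAddCommGroup EM] [NormedSpace ℝ EM]
  {M : Type*} [TopologicalSpace M] [ChartedSpace EM M]
  {EQ : Type*} [NormedAddCommGroup EQ] [NormedSpace ℝ EQ]
  {Q : Type*} [TopologicalSpace Q] [ChartedSpace EQ Q]
  {F : Type*} [NormedAddCommGroup F] [NormedSpace ℝ F]
  {N : P → Type*} [TopologicalSpace (TotalSpace F N)] [∀ p, AddCommGroup (N p)]
  [∀ p, Module ℝ (N p)] [∀ p, TopologicalSpace (N p)] [∀ p, IsTopologicalAddGroup (N p)]
  [∀ p, ContinuousSMul ℝ (N p)] [FiberBundle F N] [VectorBundle ℝ F N]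
  {ρ : P → M} {θ : ∀ p : P, TangentSpace 𝓘(ℝ, EP) p →L[ℝ] N p}

theorem IsPfaffianFibration.exists_vertical (hθ : IsPfaffianFibration EM F ρ θ) (p : P) (n : N p) :
    ∃ v ∈ vertical EP EM ρ p, θ p v = n := by
  obtain ⟨y, rfl⟩ := hθ.surjective p n
  have hmem : y ∈ vertical EP EM ρ p ⊔ kernel θ p := by rw [hθ.regular p]; trivial
  obtain ⟨a, ha, b, hb, rfl⟩ := Submodule.mem_sup.1 hmem
  have hb' : θ p b = 0 := hb
  exact ⟨a, ha, by rw [map_add, hb', add_zero]⟩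

/-- Regularity lets one correct a lift of `Y` in `ker θ` by a vertical vector with prescribed `θ`.
This surjectivity of `(dρ, θ)` is what later provides smooth lifts. -/
theorem IsPfaffianFibration.exists_mfderiv_eq (hθ : IsPfaffianFibration EM F ρ θ) (p : P)
    (Y : TangentSpace 𝓘(ℝ, EM) (ρ p)) (n : N p) :
    ∃ v, mfderiv 𝓘(ℝ, EP) 𝓘(ℝ, EM) ρ p v = Y ∧ θ p v = n := by
  obtain ⟨⟨w, hw⟩, hwY⟩ := exists_lift hθ p Y
  obtain ⟨v, hv, hvn⟩ := hθ.exists_vertical p n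
  have hw' : θ p w = 0 := hw
  have hv' : mfderiv 𝓘(ℝ, EP) 𝓘(ℝ, EM) ρ p v = 0 := hv
  exact ⟨w + v, by rw [map_add, hv', add_zero]; exact hwY, by rw [map_add, hw', hvn, zero_add]⟩

variable {f : P → Q} {τ : C^∞⟮𝓘(ℝ, EQ), Q; 𝓘(ℝ, EM), M⟯}

theorem mfderiv_comp_apply_of_fibration (hf : IsFibration EP EQ f) (p : P)
    (v : TangentSpace 𝓘(ℝ, EP) p) :
    mfderiv 𝓘(ℝ, EP) 𝓘(ℝ, EM) (τ ∘ f) p v =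
      mfderiv 𝓘(ℝ, EQ) 𝓘(ℝ, EM) τ (f p) (mfderiv 𝓘(ℝ, EP) 𝓘(ℝ, EQ) f p v) := by
  rw [mfderiv_comp p ((τ.contMDiff (f p)).mdifferentiableAt (by simp))
    ((hf.contMDiff p).mdifferentiableAt (by simp))]
  rfl

/-- The differential of `f`, as a map from the vertical space of `τ ∘ f` to the one of `τ`. -/
def verticalMap (hf : IsFibration EP EQ f) (τ : C^∞⟮𝓘(ℝ, EQ), Q; 𝓘(ℝ, EM), M⟯) (p : P) :
    vertical EP EM (τ ∘ f) p →ₗ[ℝ] vertical EQ EM τ (f p) :=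
  (mfderiv 𝓘(ℝ, EP) 𝓘(ℝ, EQ) f p).toLinearMap.restrict fun v hv ↦ by
    change mfderiv 𝓘(ℝ, EQ) 𝓘(ℝ, EM) τ (f p) (mfderiv 𝓘(ℝ, EP) 𝓘(ℝ, EQ) f p v) = 0
    rw [← mfderiv_comp_apply_of_fibration hf]
    exact hv

/-- On vertical vectors `df` and `θ` are both surjective, and both have kernel `𝔤(θ) = ker df`. -/
theorem exists_verticalEquiv (hf : IsFibration EP EQ f) (hθ : IsPfaffianFibration EM F (τ ∘ f) θ)
    (hsimple : ∀ p, symbolSpace EM (τ ∘ f) θ p = vertical EP EQ f p) (p : P) :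
    ∃ e : vertical EQ EM τ (f p) ≃ₗ[ℝ] N p,
      ∀ v : vertical EP EM (τ ∘ f) p, e (verticalMap hf τ p v) = θ p v := by
  refine exists_linearEquiv_of_ker_eq (verticalMap hf τ p)
    ((θ p).toLinearMap ∘ₗ (vertical EP EM (τ ∘ f) p).subtype) ?_ ?_ ?_
  · rintro ⟨w, hw⟩
    obtain ⟨v, rfl⟩ := hf.submersion p w
    exact ⟨⟨v, (mfderiv_comp_apply_of_fibration hf p v).trans hw⟩, rfl⟩
  · intro n
    obtain ⟨v, hv, hvn⟩ := hθ.exists_vertical p n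
    exact ⟨⟨v, hv⟩, hvn⟩
  · ext ⟨v, hv⟩
    have h1 : verticalMap hf τ p ⟨v, hv⟩ = 0 ↔ v ∈ vertical EP EQ f p := Subtype.ext_iff
    have h2 : v ∈ symbolSpace EM (τ ∘ f) θ p ↔ θ p v = 0 := ⟨fun h ↦ h.2, fun h ↦ ⟨hv, h⟩⟩
    rw [LinearMap.mem_ker, h1, ← hsimple, h2]
    rfl

/-- The isomorphism `T^τ_{f p} Q ≃ N_p` induced by `θ`. -/
def verticalEquiv (hf : IsFibration EP EQ f) (hθ : IsPfaffianFibration EM F (τ ∘ f) θ)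
    (hsimple : ∀ p, symbolSpace EM (τ ∘ f) θ p = vertical EP EQ f p) (p : P) :
    vertical EQ EM τ (f p) ≃ₗ[ℝ] N p :=
  (exists_verticalEquiv hf hθ hsimple p).choose

/-- Any `df`-lift of a `τ`-vertical vector is itself vertical for `τ ∘ f`, so `Φ` can be computed on
an arbitrary lift. -/
theorem verticalEquiv_eq (hf : IsFibration EP EQ f) (hθ : IsPfaffianFibration EM F (τ ∘ f) θ)
    (hsimple : ∀ p, symbolSpace EM (τ ∘ f) θ p = vertical EP EQ f p) (p : P)
    (w : vertical EQ EM τ (f p)) (v : TangentSpace 𝓘(ℝ, EP) p)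
    (hv : mfderiv 𝓘(ℝ, EP) 𝓘(ℝ, EQ) f p v = w) :
    verticalEquiv hf hθ hsimple p w = θ p v := by
  have hv' : v ∈ vertical EP EM (τ ∘ f) p :=
    (mfderiv_comp_apply_of_fibration hf p v).trans (by rw [hv]; exact w.2)
  have hw : w = verticalMap hf τ p ⟨v, hv'⟩ := Subtype.ext hv.symm
  rw [hw]
  exact (exists_verticalEquiv hf hθ hsimple p).choose_spec ⟨v, hv'⟩

/-- Restricted to `ker θ`, the differential of `τ ∘ f` is surjective by regularity and its kernel is
`𝔤(θ) = ker df`, so `df` factors through it. -/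
theorem exists_jet [FiniteDimensional ℝ EM] (hθ : IsPfaffianFibration EM F (τ ∘ f) θ)
    (hsimple : ∀ p, symbolSpace EM (τ ∘ f) θ p = vertical EP EQ f p) (p : P) :
    ∃ ζ : TangentSpace 𝓘(ℝ, EM) (τ (f p)) →L[ℝ] TangentSpace 𝓘(ℝ, EQ) (f p),
      ∀ w, θ p w = 0 → ζ (mfderiv 𝓘(ℝ, EP) 𝓘(ℝ, EM) (τ ∘ f) p w) =
        mfderiv 𝓘(ℝ, EP) 𝓘(ℝ, EQ) f p w := by
  obtain ⟨ζ, hζ⟩ := exists_linearMap_of_ker_le (W := TangentSpace 𝓘(ℝ, EM) (τ (f p)))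
    ((mfderiv 𝓘(ℝ, EP) 𝓘(ℝ, EM) (τ ∘ f) p).toLinearMap ∘ₗ (kernel θ p).subtype)
    ((mfderiv 𝓘(ℝ, EP) 𝓘(ℝ, EQ) f p).toLinearMap ∘ₗ (kernel θ p).subtype)
    (fun Y ↦ exists_lift hθ p Y) (fun v hv ↦ by
      have : (v : TangentSpace 𝓘(ℝ, EP) p) ∈ vertical EP EQ f p := by
        rw [← hsimple]; exact ⟨hv, v.2⟩
      exact this)
  have : FiniteDimensional ℝ (TangentSpace 𝓘(ℝ, EM) (τ (f p))) :=
    inferInstanceAs (FiniteDimensional ℝ EM)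
  have : T2Space (TangentSpace 𝓘(ℝ, EM) (τ (f p))) := inferInstanceAs (T2Space EM)
  exact ⟨LinearMap.toContinuousLinearMap ζ, fun w hw ↦ hζ ⟨w, hw⟩⟩

/-- The linear map `T_{τ (f p)} M → T_{f p} Q` whose graph is the image of `ker θ_p`. -/
def jetHom [FiniteDimensional ℝ EM] (hθ : IsPfaffianFibration EM F (τ ∘ f) θ)
    (hsimple : ∀ p, symbolSpace EM (τ ∘ f) θ p = vertical EP EQ f p) (p : P) :
    TangentSpace 𝓘(ℝ, EM) (τ (f p)) →L[ℝ] TangentSpace 𝓘(ℝ, EQ) (f p) :=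
  (exists_jet hθ hsimple p).choose

theorem jetHom_mfderiv [FiniteDimensional ℝ EM] (hθ : IsPfaffianFibration EM F (τ ∘ f) θ)
    (hsimple : ∀ p, symbolSpace EM (τ ∘ f) θ p = vertical EP EQ f p) (p : P)
    {w : TangentSpace 𝓘(ℝ, EP) p} (hw : θ p w = 0) :
    jetHom hθ hsimple p (mfderiv 𝓘(ℝ, EP) 𝓘(ℝ, EM) (τ ∘ f) p w) =
      mfderiv 𝓘(ℝ, EP) 𝓘(ℝ, EQ) f p w :=
  (exists_jet hθ hsimple p).choose_spec w hw

end Pointwise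

/-! ### Coordinate expressions and smooth local lifts -/

section Smoothness

variable {EP : Type*} [NormedAddCommGroup EP] [NormedSpace ℝ EP]
  {P : Type*} [TopologicalSpace P] [ChartedSpace EP P] [IsManifold 𝓘(ℝ, EP) ∞ P]
  {EM : Type*} [NormedAddCommGroup EM] [NormedSpace ℝ EM] 
  {M : Type*} [TopologicalSpace M] [ChartedSpace EM M] [IsManifold 𝓘(ℝ, EM) ∞ M]
  {EQ : Type*} [NormedAddCommGroup EQ] [NormedSpace ℝ EQ]
  {Q : Type*} [TopologicalSpace Q] [ChartedSpace EQ Q] [IsManifold 𝓘(ℝ, EQ) ∞ Q]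
  {F : Type*} [NormedAddCommGroup F] [NormedSpace ℝ F]
  {N : P → Type*} [TopologicalSpace (TotalSpace F N)] [∀ p, AddCommGroup (N p)]
  [∀ p, Module ℝ (N p)] [∀ p, TopologicalSpace (N p)] [∀ p, IsTopologicalAddGroup (N p)]
  [∀ p, ContinuousSMul ℝ (N p)] [FiberBundle F N] [VectorBundle ℝ F N]
  {ρ : P → M} {θ : ∀ p : P, TangentSpace 𝓘(ℝ, EP) p →L[ℝ] N p}

/-- The differential of `ρ` in the trivializations of the tangent bundles at `p₀` and `ρ p₀`. -/
def mfderivCoord (EP EM : Type*) [NormedAddCommGroup EP] [NormedSpace ℝ EP]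
    [NormedAddCommGroup EM] [NormedSpace ℝ EM] {P M : Type*} [TopologicalSpace P]
    [ChartedSpace EP P] [IsManifold 𝓘(ℝ, EP) ∞ P] [TopologicalSpace M] [ChartedSpace EM M]
    [IsManifold 𝓘(ℝ, EM) ∞ M] (ρ : P → M) (p₀ p : P) : EP →L[ℝ] EM :=
  ContinuousLinearMap.inCoordinates EP (TangentSpace 𝓘(ℝ, EP)) EM (TangentSpace 𝓘(ℝ, EM))
    p₀ p (ρ p₀) (ρ p) (mfderiv 𝓘(ℝ, EP) 𝓘(ℝ, EM) ρ p)

theorem contMDiffAt_mfderivCoord (hρ : ContMDiff 𝓘(ℝ, EP) 𝓘(ℝ, EM) ∞ ρ) (p₀ : P) :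
    ContMDiffAt 𝓘(ℝ, EP) 𝓘(ℝ, EP →L[ℝ] EM) ∞ (mfderivCoord EP EM ρ p₀) p₀ :=
  (hρ p₀).mfderiv_const (by simp)

/-- An `N`-valued form in the trivializations of `TP` and `N` at `p₀`. -/
def formCoord (F : Type*) [NormedAddCommGroup F] [NormedSpace ℝ F]
    [TopologicalSpace (TotalSpace F N)]
    [FiberBundle F N] [VectorBundle ℝ F N]
    (θ : ∀ p : P, TangentSpace 𝓘(ℝ, EP) p →L[ℝ] N p) (p₀ p : P) : EP →L[ℝ] F :=
  ContinuousLinearMap.inCoordinates EP (TangentSpace 𝓘(ℝ, EP)) F N p₀ p p₀ p (θ p)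

theorem IsPfaffianFibration.contMDiffAt_formCoord (hθ : IsPfaffianFibration EM F ρ θ) (p₀ : P) :
    ContMDiffAt 𝓘(ℝ, EP) 𝓘(ℝ, EP →L[ℝ] F) ∞ (formCoord F θ p₀) p₀ :=
  ((contMDiffAt_hom_bundle _).1 (hθ.contMDiff p₀)).2

/-- The tangent vector at `p` with coordinates `u` in the trivialization of `TP` at `p₀`. -/
def tangentOfCoord (p₀ p : P) (u : EP) : TangentSpace 𝓘(ℝ, EP) p :=
  (trivializationAt EP (TangentSpace 𝓘(ℝ, EP)) p₀).symmL ℝ p u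

theorem mfderivCoord_eq {p₀ p : P} {ρ : P → M}
    (hp : ρ p ∈ (trivializationAt EM (TangentSpace 𝓘(ℝ, EM)) (ρ p₀)).baseSet) (u : EP) :
    mfderivCoord EP EM ρ p₀ p u =
      (trivializationAt EM (TangentSpace 𝓘(ℝ, EM)) (ρ p₀)).continuousLinearEquivAt ℝ (ρ p) hp
        (mfderiv 𝓘(ℝ, EP) 𝓘(ℝ, EM) ρ p (tangentOfCoord p₀ p u)) := by
  simp only [mfderivCoord, ContinuousLinearMap.inCoordinates, ContinuousLinearMap.comp_apply]
  rw [Trivialization.coe_continuousLinearEquivAt_eq]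
  rfl

theorem formCoord_eq {p₀ p : P} (hp : p ∈ (trivializationAt F N p₀).baseSet) (u : EP) :
    formCoord F θ p₀ p u =
      (trivializationAt F N p₀).continuousLinearEquivAt ℝ p hp (θ p (tangentOfCoord p₀ p u)) := by
  simp only [formCoord, ContinuousLinearMap.inCoordinates, ContinuousLinearMap.comp_apply]
  rw [Trivialization.coe_continuousLinearEquivAt_eq]
  rfl

theorem tangentOfCoord_surjective (p₀ : P) (v : TangentSpace 𝓘(ℝ, EP) p₀) :
    ∃ u, tangentOfCoord p₀ p₀ u = v :=
  ⟨_, Trivialization.symmL_continuousLinearMapAt _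
    (FiberBundle.mem_baseSet_trivializationAt' p₀) v⟩

theorem eventually_mem_baseSet (hρ : Continuous ρ) (p₀ : P) :
    ∀ᶠ p in 𝓝 p₀, ρ p ∈ (trivializationAt EM (TangentSpace 𝓘(ℝ, EM)) (ρ p₀)).baseSet :=
  hρ.continuousAt ((trivializationAt EM (TangentSpace 𝓘(ℝ, EM)) (ρ p₀)).open_baseSet.mem_nhds
    (FiberBundle.mem_baseSet_trivializationAt' _))

/-- Applied to `f`, this lifts sections of `f^*TQ` smoothly to `TP`, which gives the smoothness of
`Φ`. -/
theorem IsFibration.exists_smooth_lift [FiniteDimensional ℝ EM] (hρ : IsFibration EP EM ρ)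
    (p₀ : P) :
    ∃ B : P → EM →L[ℝ] EP, ContMDiffAt 𝓘(ℝ, EP) 𝓘(ℝ, EM →L[ℝ] EP) ∞ B p₀ ∧
      ∀ᶠ p in 𝓝 p₀, ∀ y, mfderivCoord EP EM ρ p₀ p (B p y) = y := by
  refine exists_smooth_rightInverse (contMDiffAt_mfderivCoord hρ.contMDiff p₀) fun y ↦ ?_
  have hp := (eventually_mem_baseSet (EM := EM) hρ.contMDiff.continuous p₀).self_of_nhds
  obtain ⟨v, hv⟩ := hρ.submersion p₀
    (((trivializationAt EM (TangentSpace 𝓘(ℝ, EM)) (ρ p₀)).continuousLinearEquivAt ℝ _ hp).symm y)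
  obtain ⟨u, rfl⟩ := tangentOfCoord_surjective p₀ v
  exact ⟨u, by rw [mfderivCoord_eq hp, hv, ContinuousLinearEquiv.apply_symm_apply]⟩

/-- `(dρ, θ)` is surjective, so it has a smooth right inverse near `p₀`. Inputs `(0, s)` give
vertical vectors with prescribed `θ`, used for `Φ⁻¹`; inputs `(y, 0)` give lifts in `ker θ`, used
for `ζ`. -/
theorem IsPfaffianFibration.exists_smooth_lift [FiniteDimensional ℝ EM] [FiniteDimensional ℝ F]
    (hθ : IsPfaffianFibration EM F ρ θ) (p₀ : P) :
    ∃ B : P → EM × F →L[ℝ] EP, ContMDiffAt 𝓘(ℝ, EP) 𝓘(ℝ, EM × F →L[ℝ] EP) ∞ B p₀ ∧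
      ∀ᶠ p in 𝓝 p₀, ∀ y, mfderivCoord EP EM ρ p₀ p (B p y) = y.1 ∧
        formCoord F θ p₀ p (B p y) = y.2 := by
  have hsmooth : ContMDiffAt 𝓘(ℝ, EP) 𝓘(ℝ, EP →L[ℝ] EM × F) ∞
      (fun p ↦ (mfderivCoord EP EM ρ p₀ p).prod (formCoord F θ p₀ p)) p₀ := by
    have h1 : ContMDiffAt 𝓘(ℝ, EP) 𝓘(ℝ, EP →L[ℝ] EM × F) ∞
        (fun p ↦ (ContinuousLinearMap.inl ℝ EM F).comp (mfderivCoord EP EM ρ p₀ p)) p₀ :=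
      contMDiffAt_const.clm_comp (contMDiffAt_mfderivCoord hθ.fibration.contMDiff p₀)
    have h2 : ContMDiffAt 𝓘(ℝ, EP) 𝓘(ℝ, EP →L[ℝ] EM × F) ∞
        (fun p ↦ (ContinuousLinearMap.inr ℝ EM F).comp (formCoord F θ p₀ p)) p₀ :=
      contMDiffAt_const.clm_comp (hθ.contMDiffAt_formCoord p₀)
    refine (h1.add h2).congr_of_eventuallyEq (Filter.Eventually.of_forall fun p ↦ ?_)
    ext u <;> simp
  obtain ⟨B, hB, h⟩ := exists_smooth_rightInverse hsmooth fun ⟨y, s⟩ ↦ by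
    have hp := (eventually_mem_baseSet (EM := EM) hθ.fibration.contMDiff.continuous p₀).self_of_nhds
    have hp' : p₀ ∈ (trivializationAt F N p₀).baseSet :=
      FiberBundle.mem_baseSet_trivializationAt' p₀
    obtain ⟨v, hv, hv'⟩ := hθ.exists_mfderiv_eq p₀
      (((trivializationAt EM (TangentSpace 𝓘(ℝ, EM)) (ρ p₀)).continuousLinearEquivAt ℝ _ hp).symm y)
      (((trivializationAt F N p₀).continuousLinearEquivAt ℝ _ hp').symm s)
    obtain ⟨u, rfl⟩ := tangentOfCoord_surjective p₀ v
    refine ⟨u, Prod.ext ?_ ?_⟩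
    · exact (mfderivCoord_eq hp u).trans (by rw [hv, ContinuousLinearEquiv.apply_symm_apply])
    · exact (formCoord_eq hp' u).trans (by rw [hv', ContinuousLinearEquiv.apply_symm_apply])
  refine ⟨B, hB, h.mono fun p hp y ↦ ?_⟩
  exact ⟨congrArg Prod.fst (hp y), congrArg Prod.snd (hp y)⟩

end Smoothness

/-! ### The isomorphism `Φ`, the map `i`, and uniqueness -/

section Construction

variable {EP : Type*} [NormedAddCommGroup EP] [NormedSpace ℝ EP]
  {P : Type*} [TopologicalSpace P] [ChartedSpace EP P] [IsManifold 𝓘(ℝ, EP) ∞ P]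
  {EM : Type*} [NormedAddCommGroup EM] [NormedSpace ℝ EM] [FiniteDimensional ℝ EM]
  {M : Type*} [TopologicalSpace M] [ChartedSpace EM M] [IsManifold 𝓘(ℝ, EM) ∞ M]
  {EQ : Type*} [NormedAddCommGroup EQ] [NormedSpace ℝ EQ] [FiniteDimensional ℝ EQ]
  {Q : Type*} [TopologicalSpace Q] [ChartedSpace EQ Q] [IsManifold 𝓘(ℝ, EQ) ∞ Q]
  {F : Type*} [NormedAddCommGroup F] [NormedSpace ℝ F] [FiniteDimensional ℝ F]
  {N : P → Type*} [TopologicalSpace (TotalSpace F N)] [∀ p, AddCommGroup (N p)]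
  [∀ p, Module ℝ (N p)] [∀ p, TopologicalSpace (N p)] [∀ p, IsTopologicalAddGroup (N p)]
  [∀ p, ContinuousSMul ℝ (N p)] [FiberBundle F N] [VectorBundle ℝ F N]
  {θ : ∀ p : P, TangentSpace 𝓘(ℝ, EP) p →L[ℝ] N p}
  {f : P → Q} {τ : C^∞⟮𝓘(ℝ, EQ), Q; 𝓘(ℝ, EM), M⟯}

/-- Locally `Φ w = θ (B w)` with `B` a smooth right inverse of `df`. -/
theorem contMDiffOn_verticalEquiv (hf : IsFibration EP EQ f)
    (hθ : IsPfaffianFibration EM F (τ ∘ f) θ)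
    (hsimple : ∀ p, symbolSpace EM (τ ∘ f) θ p = vertical EP EQ f p)
    {U : Set P} (hU : IsOpen U) (w : ∀ p, vertical EQ EM τ (f p))
    (hw : ContMDiffOn 𝓘(ℝ, EP) 𝓘(ℝ, EQ).tangent ∞
      (fun p ↦ (⟨f p, (w p : TangentSpace 𝓘(ℝ, EQ) (f p))⟩ : TangentBundle 𝓘(ℝ, EQ) Q)) U) :
    ContMDiffOn 𝓘(ℝ, EP) (𝓘(ℝ, EP).prod 𝓘(ℝ, F)) ∞
      (fun p ↦ TotalSpace.mk' F (E := N) p (verticalEquiv hf hθ hsimple p (w p))) U := by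
  intro p₀ hp₀
  have hw₀ := (contMDiffAt_totalSpace.1 (hw.contMDiffAt (hU.mem_nhds hp₀))).2
  obtain ⟨B, hB, hBinv⟩ := hf.exists_smooth_lift p₀
  refine ContMDiffAt.contMDiffWithinAt (contMDiffAt_totalSpace.2 ⟨contMDiffAt_id, ?_⟩)
  refine ((hθ.contMDiffAt_formCoord p₀).clm_apply (hB.clm_apply hw₀)).congr_of_eventuallyEq ?_
  filter_upwards [hBinv, eventually_mem_baseSet (EM := EQ) hf.contMDiff.continuous p₀,
    (trivializationAt F N p₀).open_baseSet.mem_nhds (FiberBundle.mem_baseSet_trivializationAt' p₀)]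
    with p hp hpQ hpN
  rw [formCoord_eq hpN, verticalEquiv_eq hf hθ hsimple p (w p) _ ?_]
  · rfl
  · have h := hp ((trivializationAt EQ (TangentSpace 𝓘(ℝ, EQ)) (f p₀))
      ⟨f p, (w p : TangentSpace 𝓘(ℝ, EQ) (f p))⟩).2
    rw [mfderivCoord_eq hpQ] at h
    exact ((trivializationAt EQ (TangentSpace 𝓘(ℝ, EQ)) (f p₀)).continuousLinearEquivAt ℝ
      (f p) hpQ).injective h

/-- Locally `Φ⁻¹ s = df (B (0, s))` with `B` a smooth right inverse of `(dρ, θ)`, where `ρ = τ ∘ f`.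
-/
theorem contMDiffOn_verticalEquiv_symm (hf : IsFibration EP EQ f)
    (hθ : IsPfaffianFibration EM F (τ ∘ f) θ)
    (hsimple : ∀ p, symbolSpace EM (τ ∘ f) θ p = vertical EP EQ f p)
    {U : Set P} (hU : IsOpen U) (s : ∀ p, N p)
    (hs : ContMDiffOn 𝓘(ℝ, EP) (𝓘(ℝ, EP).prod 𝓘(ℝ, F)) ∞
      (fun p ↦ TotalSpace.mk' F (E := N) p (s p)) U) :
    ContMDiffOn 𝓘(ℝ, EP) 𝓘(ℝ, EQ).tangent ∞
      (fun p ↦ (⟨f p, ((verticalEquiv hf hθ hsimple p).symm (s p) : TangentSpace 𝓘(ℝ, EQ) (f p))⟩ :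
        TangentBundle 𝓘(ℝ, EQ) Q)) U := by
  intro p₀ hp₀
  have hs₀ := (contMDiffAt_totalSpace.1 (hs.contMDiffAt (hU.mem_nhds hp₀))).2
  obtain ⟨B, hB, hBinv⟩ := hθ.exists_smooth_lift p₀
  refine ContMDiffAt.contMDiffWithinAt (contMDiffAt_totalSpace.2 ⟨hf.contMDiff p₀, ?_⟩)
  refine ((contMDiffAt_mfderivCoord hf.contMDiff p₀).clm_apply (hB.clm_apply
    (contMDiffAt_const (c := (0 : EM)) |>.prodMk_space hs₀))).congr_of_eventuallyEq ?_
  filter_upwards [hBinv, eventually_mem_baseSet (EM := EQ) hf.contMDiff.continuous p₀,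
    eventually_mem_baseSet (EM := EM) hθ.fibration.contMDiff.continuous p₀,
    (trivializationAt F N p₀).open_baseSet.mem_nhds (FiberBundle.mem_baseSet_trivializationAt' p₀)]
    with p hp hpQ hpM hpN
  obtain ⟨h1, h2⟩ := hp (0, (trivializationAt F N p₀ ⟨p, s p⟩).2)
  set v := tangentOfCoord p₀ p (B p (0, (trivializationAt F N p₀ ⟨p, s p⟩).2)) with hv
  rw [mfderivCoord_eq hpM, EmbeddingLike.map_eq_zero_iff] at h1
  rw [formCoord_eq hpN] at h2
  have h2' : θ p v = s p :=
    ((trivializationAt F N p₀).continuousLinearEquivAt ℝ p hpN).injective h2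
  let w : vertical EQ EM τ (f p) := ⟨mfderiv 𝓘(ℝ, EP) 𝓘(ℝ, EQ) f p v,
    (mfderiv_comp_apply_of_fibration hf p v).symm.trans h1⟩
  have hw : (verticalEquiv hf hθ hsimple p).symm (s p) = w := by
    rw [LinearEquiv.symm_apply_eq, verticalEquiv_eq hf hθ hsimple p w v rfl, h2']
  rw [hw, mfderivCoord_eq hpQ]
  rfl

variable (EP) in
/-- The bundle isomorphism `f^*(T^τ Q) → N` induced by `θ`. -/
def verticalIso (hf : IsFibration EP EQ f) (hθ : IsPfaffianFibration EM F (τ ∘ f) θ)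
    (hsimple : ∀ p, symbolSpace EM (τ ∘ f) θ p = vertical EP EQ f p) :
    VerticalIso EP F N f τ where
  equiv := verticalEquiv hf hθ hsimple
  smooth_toFun _ hU w hw := contMDiffOn_verticalEquiv hf hθ hsimple hU w hw
  smooth_invFun _ hU s hs := contMDiffOn_verticalEquiv_symm hf hθ hsimple hU s hs

theorem mfderiv_jetHom (hf : IsFibration EP EQ f) (hθ : IsPfaffianFibration EM F (τ ∘ f) θ)
    (hsimple : ∀ p, symbolSpace EM (τ ∘ f) θ p = vertical EP EQ f p) (p : P)
    (Y : TangentSpace 𝓘(ℝ, EM) (τ (f p))) :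
    mfderiv 𝓘(ℝ, EQ) 𝓘(ℝ, EM) τ (f p) (jetHom hθ hsimple p Y) = Y := by
  obtain ⟨⟨w, hw⟩, rfl⟩ := exists_lift hθ p Y
  exact (congrArg _ (jetHom_mfderiv hθ hsimple p hw)).trans
    (mfderiv_comp_apply_of_fibration hf p w).symm

/-- The map `P → J¹Q`, `p ↦ (f p, ζ_p)`, where the graph of `ζ_p` is the image of `ker θ_p`. -/
def jetMap (hf : IsFibration EP EQ f) (hθ : IsPfaffianFibration EM F (τ ∘ f) θ)
    (hsimple : ∀ p, symbolSpace EM (τ ∘ f) θ p = vertical EP EQ f p) (p : P) : Jet1 τ :=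
  ⟨⟨f p, jetHom hθ hsimple p⟩, mfderiv_jetHom hf hθ hsimple p⟩

/-- A linear map `T_{τ q} M → T_q Q` in the trivializations at `τ q₀` and `q₀`. -/
def homCoord (τ : C^∞⟮𝓘(ℝ, EQ), Q; 𝓘(ℝ, EM), M⟯) (q₀ q : Q)
    (ζ : TangentSpace 𝓘(ℝ, EM) (τ q) →L[ℝ] TangentSpace 𝓘(ℝ, EQ) q) : EM →L[ℝ] EQ :=
  ContinuousLinearMap.inCoordinates EM (TangentSpace 𝓘(ℝ, EM)) EQ (TangentSpace 𝓘(ℝ, EQ))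
    (τ q₀) (τ q) q₀ q ζ

/-- The criterion for smoothness into `Hom(τ^*TM, TQ)` uses the pulled-back trivialization of
`τ^*TM`; over its base set this is the trivialization of `TM` at `τ q₀`, in which the computations
are made. -/
theorem inCoordinates_pullback {q₀ q : Q}
    (hq : τ q ∈ (trivializationAt EM (TangentSpace 𝓘(ℝ, EM)) (τ q₀)).baseSet)
    (ζ : TangentSpace 𝓘(ℝ, EM) (τ q) →L[ℝ] TangentSpace 𝓘(ℝ, EQ) q) :
    ContinuousLinearMap.inCoordinates EM (τ *ᵖ (fun x : M ↦ TangentSpace 𝓘(ℝ, EM) x))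
      EQ (TangentSpace 𝓘(ℝ, EQ)) q₀ q q₀ q ζ = homCoord τ q₀ q ζ := by
  ext y
  set e := trivializationAt EM (TangentSpace 𝓘(ℝ, EM)) (τ q₀)
  set e' := trivializationAt EM (τ *ᵖ (fun x : M ↦ TangentSpace 𝓘(ℝ, EM) x)) q₀
  have h1 : e'.continuousLinearMapAt ℝ q (e'.symmL ℝ q y) = y :=
    e'.continuousLinearMapAt_symmL hq y
  rw [e'.continuousLinearMapAt_apply_of_mem ℝ hq] at h1
  have h2 : ∀ Y : TangentSpace 𝓘(ℝ, EM) (τ q), e.symmL ℝ (τ q) (e ⟨τ q, Y⟩).2 = Y := fun Y ↦ by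
    rw [← e.continuousLinearMapAt_apply_of_mem ℝ hq, e.symmL_continuousLinearMapAt hq]
  have h3 : e.symmL ℝ (τ q) y = e'.symmL ℝ q y :=
    (congrArg (e.symmL ℝ (τ q)) h1.symm).trans (h2 _)
  exact congrArg (fun Y : TangentSpace 𝓘(ℝ, EM) (τ q) ↦ (trivializationAt EQ
    (TangentSpace 𝓘(ℝ, EQ)) q₀).continuousLinearMapAt ℝ q (ζ Y)) h3.symm

/-- Since `B (y, 0)` is a lift of `y` in `ker θ`, locally `ζ y = df (B (y, 0))`, a composite of
smooth families. -/
theorem contMDiffAt_homCoord_jetHom (hf : IsFibration EP EQ f)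
    (hθ : IsPfaffianFibration EM F (τ ∘ f) θ)
    (hsimple : ∀ p, symbolSpace EM (τ ∘ f) θ p = vertical EP EQ f p) (p₀ : P) :
    ContMDiffAt 𝓘(ℝ, EP) 𝓘(ℝ, EM →L[ℝ] EQ) ∞
      (fun p ↦ homCoord τ (f p₀) (f p) (jetHom hθ hsimple p)) p₀ := by
  obtain ⟨B, hB, hBinv⟩ := hθ.exists_smooth_lift p₀
  refine ((contMDiffAt_mfderivCoord hf.contMDiff p₀).clm_comp (hB.clm_comp
    (contMDiffAt_const (c := ContinuousLinearMap.inl ℝ EM F)))).congr_of_eventuallyEq ?_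
  filter_upwards [hBinv, eventually_mem_baseSet (EM := EQ) hf.contMDiff.continuous p₀,
    eventually_mem_baseSet (EM := EM) hθ.fibration.contMDiff.continuous p₀,
    (trivializationAt F N p₀).open_baseSet.mem_nhds (FiberBundle.mem_baseSet_trivializationAt' p₀)]
    with p hp hpQ hpM hpN
  ext y
  obtain ⟨h1, h2⟩ := hp (y, 0)
  obtain ⟨v, hv⟩ : ∃ v, v = tangentOfCoord p₀ p (B p (y, 0)) := ⟨_, rfl⟩
  rw [mfderivCoord_eq hpM, ← hv] at h1
  rw [formCoord_eq hpN, ← hv, EmbeddingLike.map_eq_zero_iff] at h2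
  have h3 := jetHom_mfderiv hθ hsimple p h2
  change _ = y at h1
  rw [ContinuousLinearMap.comp_apply, ContinuousLinearMap.comp_apply,
    ContinuousLinearMap.inl_apply, mfderivCoord_eq hpQ, ← hv, ← h3, ← h1,
    Trivialization.coe_continuousLinearEquivAt_eq, Trivialization.coe_continuousLinearEquivAt_eq]
  have h4 : (trivializationAt EM (TangentSpace 𝓘(ℝ, EM)) (τ (f p₀))).symmL ℝ (τ (f p))
      ((trivializationAt EM (TangentSpace 𝓘(ℝ, EM)) (τ (f p₀))).continuousLinearMapAt ℝ (τ (f p))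
        (mfderiv 𝓘(ℝ, EP) 𝓘(ℝ, EM) (τ ∘ f) p v)) = mfderiv 𝓘(ℝ, EP) 𝓘(ℝ, EM) (τ ∘ f) p v :=
    Trivialization.symmL_continuousLinearMapAt _ hpM _
  exact congrArg (fun Y ↦ (trivializationAt EQ (TangentSpace 𝓘(ℝ, EQ)) (f p₀)).continuousLinearMapAt
    ℝ (f p) (jetHom hθ hsimple p Y)) h4

theorem contMDiffInto_jetMap (hf : IsFibration EP EQ f) (hθ : IsPfaffianFibration EM F (τ ∘ f) θ)
    (hsimple : ∀ p, symbolSpace EM (τ ∘ f) θ p = vertical EP EQ f p) :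
    Jet1.ContMDiffInto EP (jetMap hf hθ hsimple) := fun p₀ ↦
  (contMDiffAt_hom_bundle (fun p ↦ (jetMap hf hθ hsimple p).1)).2
    ⟨hf.contMDiff p₀, (contMDiffAt_homCoord_jetHom hf hθ hsimple p₀).congr_of_eventuallyEq
      ((eventually_mem_baseSet (EM := EM) hθ.fibration.contMDiff.continuous p₀).mono
        fun _ hp ↦ inCoordinates_pullback hp _)⟩

/-- The pullback of the Cartan form along a smooth map `j : P → J¹Q`. -/
theorem cartanForm_differential {j : P → Jet1 τ} (hj : Jet1.ContMDiffInto EP j) (p : P)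
    (v : TangentSpace 𝓘(ℝ, EP) p) :
    (cartanForm (j p) (Jet1.differential j p v) : TangentSpace 𝓘(ℝ, EQ) (j p).1.proj) =
      mfderiv 𝓘(ℝ, EP) 𝓘(ℝ, EQ) (fun x ↦ (j x).1.proj) p v -
        (j p).1.hom (mfderiv 𝓘(ℝ, EP) 𝓘(ℝ, EM) (fun x ↦ τ (j x).1.proj) p v) := by
  have hjd : MDifferentiableAt 𝓘(ℝ, EP) (jetModel EM EQ) (fun x ↦ (j x).1) p :=
    (hj p).mdifferentiableAt (by simp)
  have hproj := (contMDiff_proj (IB := 𝓘(ℝ, EQ)) (n := ∞) (F := EM →L[ℝ] EQ) (fun q : Q ↦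
      (τ *ᵖ (fun x : M ↦ TangentSpace 𝓘(ℝ, EM) x)) q →L[ℝ] TangentSpace 𝓘(ℝ, EQ) q))
  have h1 : MDifferentiableAt (jetModel EM EQ) 𝓘(ℝ, EQ) (fun y : HomBundle τ ↦ y.proj) (j p).1 :=
    (hproj (j p).1).mdifferentiableAt (by simp)
  have h2 : MDifferentiableAt (jetModel EM EQ) 𝓘(ℝ, EM) (fun y : HomBundle τ ↦ τ y.proj) (j p).1 :=
    ((τ.contMDiff.comp hproj) (j p).1).mdifferentiableAt (by simp)
  have h3 := DFunLike.congr_fun (mfderiv_comp p h1 hjd) v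
  have h4 := DFunLike.congr_fun (mfderiv_comp p h2 hjd) v
  exact congrArg₂ (fun a b ↦ a - (j p).1.hom b) h3.symm h4.symm

theorem isCartanBundleMap_jetMap (hf : IsFibration EP EQ f)
    (hθ : IsPfaffianFibration EM F (τ ∘ f) θ)
    (hsimple : ∀ p, symbolSpace EM (τ ∘ f) θ p = vertical EP EQ f p) :
    IsCartanBundleMap (verticalIso EP hf hθ hsimple) θ (jetMap hf hθ hsimple) where
  contMDiff := contMDiffInto_jetMap hf hθ hsimple
  proj_eq _ := rfl
  comp_pullback_cartan p v := by
    -- With `u` vertical and `v - u ∈ ker θ`, the relation `df = ζ ∘ dρ` at `v - u` gives `df v - ζ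
    -- (dρ v) = df u`, and `Φ (df u) = θ u = θ v`.
    obtain ⟨u, hu, hv⟩ := hθ.exists_vertical p (θ p v)
    have hw : θ p (v - u) = 0 := by rw [map_sub, hv, sub_self]
    have hu' : mfderiv 𝓘(ℝ, EP) 𝓘(ℝ, EM) (τ ∘ f) p u = 0 := hu
    have h1 := jetHom_mfderiv hθ hsimple p hw
    rw [map_sub, hu', sub_zero, map_sub] at h1
    rw [← hv]
    refine verticalEquiv_eq hf hθ hsimple p _ u ?_
    refine Eq.trans ?_ (cartanForm_differential (contMDiffInto_jetMap hf hθ hsimple) p v).symm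
    exact eq_sub_of_add_eq' (eq_sub_iff_add_eq.1 h1)

/-- `Φ` is injective, so the pulled-back Cartan form vanishes on `ker θ`. The types are read in the
model spaces because `(j p).1.proj` and `f p` are only propositionally equal. -/
theorem IsCartanBundleMap.hom_mfderiv {Φ : VerticalIso EP F N f τ}
    {j : P → Jet1 τ} (hj : IsCartanBundleMap Φ θ j) (p : P) {w : TangentSpace 𝓘(ℝ, EP) p}
    (hw : θ p w = 0) :
    (show EM →L[ℝ] EQ from (j p).1.hom) (show EM from mfderiv 𝓘(ℝ, EP) 𝓘(ℝ, EM) (τ ∘ f) p w) =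
      (show EQ from mfderiv 𝓘(ℝ, EP) 𝓘(ℝ, EQ) f p w) := by
  have h := hj.comp_pullback_cartan p w
  rw [hw, LinearEquiv.map_eq_zero_iff, LinearEquiv.map_eq_zero_iff] at h
  have h' := cartanForm_differential hj.contMDiff p w
  rw [h] at h'
  -- Generalizing `f` allows the equality `pr ∘ j = f` to be eliminated without casts between
  -- tangent spaces.
  have key : ∀ g : P → Q, (fun x ↦ (j x).1.proj) = g →
      (show EM →L[ℝ] EQ from (j p).1.hom) (show EM from mfderiv 𝓘(ℝ, EP) 𝓘(ℝ, EM) (τ ∘ g) p w) =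
        (show EQ from mfderiv 𝓘(ℝ, EP) 𝓘(ℝ, EQ) g p w) := by
    rintro _ rfl
    exact (sub_eq_zero.1 h'.symm).symm
  exact key f (funext hj.proj_eq)

theorem Jet1.ext_hom {z z' : Jet1 τ} (h : z.1.proj = z'.1.proj)
    (h' : ∀ Y : EM, (show EM →L[ℝ] EQ from z.1.hom) Y = (show EM →L[ℝ] EQ from z'.1.hom) Y) :
    z = z' := by
  obtain ⟨⟨q, ζ⟩, hz⟩ := z
  obtain ⟨⟨q', ζ'⟩, hz'⟩ := z'
  obtain rfl : q = q' := h
  obtain rfl : ζ = ζ' := ContinuousLinearMap.ext h'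
  rfl

/-- `ker θ` projects onto `TM`, so `hom_mfderiv` determines the linear map at every point. -/
theorem IsCartanBundleMap.unique (hθ : IsPfaffianFibration EM F (τ ∘ f) θ)
    {Φ : VerticalIso EP F N f τ} {i j : P → Jet1 τ} (hi : IsCartanBundleMap Φ θ i)
    (hj : IsCartanBundleMap Φ θ j) : i = j := by
  funext p
  refine Jet1.ext_hom ((hi.proj_eq p).trans (hj.proj_eq p).symm) fun Y ↦ ?_
  obtain ⟨⟨w, hw⟩, rfl⟩ := exists_lift hθ p Y
  exact (hi.hom_mfderiv p hw).trans (hj.hom_mfderiv p hw).symm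

end Construction

/-! ### Lie brackets of fields satisfying `dg = Z ∘ dr` -/

section Bracket

variable {E : Type*} [NormedAddCommGroup E] [NormedSpace ℝ E]
  {G : Type*} [NormedAddCommGroup G] [NormedSpace ℝ G]
  {H : Type*} [NormedAddCommGroup H] [NormedSpace ℝ H]

/-- If `V` and `W` satisfy `dg = Z ∘ dr` and `V` annihilates `r` and `Z` at `x`, then `[V, W]`
satisfies `dg = Z ∘ dr` at `x`. -/
theorem fderiv_lieBracket_eq_of_fderiv_eq {g : E → G} {r : E → H} {Z : E → H →L[ℝ] G}
    {V W : E → E} {x : E} (hg : ContDiffAt ℝ 2 g x) (hr : ContDiffAt ℝ 2 r x)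
    (hZ : DifferentiableAt ℝ Z x) (hV : DifferentiableAt ℝ V x) (hW : DifferentiableAt ℝ W x)
    (hgV : ∀ᶠ y in 𝓝 x, fderiv ℝ g y (V y) = Z y (fderiv ℝ r y (V y)))
    (hgW : ∀ᶠ y in 𝓝 x, fderiv ℝ g y (W y) = Z y (fderiv ℝ r y (W y)))
    (hrx : fderiv ℝ r x (V x) = 0) (hZx : fderiv ℝ Z x (V x) = 0) :
    fderiv ℝ g x (VectorField.lieBracket ℝ V W x) =
      Z x (fderiv ℝ r x (VectorField.lieBracket ℝ V W x)) := by
  have hd : DifferentiableAt ℝ (fderiv ℝ r) x :=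
    (hr.fderiv_right (m := 1) (by norm_num)).differentiableAt (by simp)
  -- By the product rule the two sides differ by `(dZ V)(dr W) - (dZ W)(dr V)` at `x`, and both
  -- terms vanish.
  rw [fderiv_lieBracket_apply hg hV hW, fderiv_lieBracket_apply hr hV hW,
    Filter.EventuallyEq.fderiv_eq hgV, Filter.EventuallyEq.fderiv_eq hgW,
    fderiv_clm_apply hZ (hd.clm_apply hV), fderiv_clm_apply hZ (hd.clm_apply hW)]
  simp [hrx, hZx]

variable {EP : Type*} [NormedAddCommGroup EP] [NormedSpace ℝ EP] [CompleteSpace EP]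
  {P : Type*} [TopologicalSpace P] [ChartedSpace EP P] [IsManifold 𝓘(ℝ, EP) ∞ P]

/-- The coordinate expression of a vector field in the preferred chart at `p`. -/
def chartField (p : P) (X : ∀ x : P, TangentSpace 𝓘(ℝ, EP) x) : EP → EP :=
  VectorField.mpullbackWithin 𝓘(ℝ, EP) 𝓘(ℝ, EP) (extChartAt 𝓘(ℝ, EP) p).symm X
    (range 𝓘(ℝ, EP))

theorem mfderiv_symm_chartField (p : P) (X : ∀ x : P, TangentSpace 𝓘(ℝ, EP) x) {x : EP}
    (hx : x ∈ (extChartAt 𝓘(ℝ, EP) p).target) :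
    mfderiv 𝓘(ℝ, EP) 𝓘(ℝ, EP) (extChartAt 𝓘(ℝ, EP) p).symm x (chartField (EP := EP) p X x) =
      X ((extChartAt 𝓘(ℝ, EP) p).symm x) := by
  have h : chartField p X x = (mfderiv 𝓘(ℝ, EP) 𝓘(ℝ, EP) (extChartAt 𝓘(ℝ, EP) p).symm x).inverse
      (X ((extChartAt 𝓘(ℝ, EP) p).symm x)) := by
    rw [← mfderivWithin_univ, ← range_id]
    rfl
  rw [h]
  exact (isInvertible_mfderiv_extChartAt_symm p hx).self_apply_inverse _

theorem differentiableAt_chartField {p : P} {X : ∀ x : P, TangentSpace 𝓘(ℝ, EP) x}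
    (hX : MDifferentiableAt 𝓘(ℝ, EP) 𝓘(ℝ, EP).tangent
      (fun x ↦ (⟨x, X x⟩ : TangentBundle 𝓘(ℝ, EP) P)) p) :
    DifferentiableAt ℝ (chartField p X) (extChartAt 𝓘(ℝ, EP) p p) := by
  have h : DifferentiableWithinAt ℝ (chartField p X)
      ((extChartAt 𝓘(ℝ, EP) p).symm ⁻¹' univ ∩ range 𝓘(ℝ, EP)) (extChartAt 𝓘(ℝ, EP) p p) :=
    MDifferentiableWithinAt.differentiableWithinAt_mpullbackWithin_vectorField
      (hX.mdifferentiableWithinAt (s := univ))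
  exact h.differentiableAt (by simp)

/-- The preferred chart at `p` has identity differential at `p`, so no pushforward remains. -/
theorem mlieBracket_eq_lieBracket_chartField (p : P) (X Y : ∀ x : P, TangentSpace 𝓘(ℝ, EP) x) :
    VectorField.mlieBracket 𝓘(ℝ, EP) X Y p =
      VectorField.lieBracket ℝ (chartField p X) (chartField p Y) (extChartAt 𝓘(ℝ, EP) p p) := by
  have hinv : (mfderiv 𝓘(ℝ, EP) 𝓘(ℝ, EP) (extChartAt 𝓘(ℝ, EP) p) p).inverse =
      ContinuousLinearMap.id ℝ EP := by
    rw [mfderiv_extChartAt_self]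
    exact ContinuousLinearMap.inverse_id
  rw [← VectorField.mlieBracketWithin_univ, VectorField.mlieBracketWithin_apply, hinv,
    ← VectorField.lieBracketWithin_univ, preimage_univ, univ_inter, modelWithCornersSelf_coe,
    range_id]
  simp only [chartField, modelWithCornersSelf_coe, range_id]
  rfl

theorem mfderiv_extChartAt_symm_self (p : P) (v : EP) :
    mfderiv 𝓘(ℝ, EP) 𝓘(ℝ, EP) (extChartAt 𝓘(ℝ, EP) p).symm (extChartAt 𝓘(ℝ, EP) p p) v = v := by
  have h := mfderivWithin_range_extChartAt_symm (I := 𝓘(ℝ, EP)) (x := p)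
  rw [modelWithCornersSelf_coe, range_id, mfderivWithin_univ] at h
  exact DFunLike.congr_fun h v

theorem fderiv_comp_extChartAt_symm_self {k : P → G} {p : P}
    (hk : MDifferentiableAt 𝓘(ℝ, EP) 𝓘(ℝ, G) k p) (v : EP) :
    fderiv ℝ (k ∘ (extChartAt 𝓘(ℝ, EP) p).symm) (extChartAt 𝓘(ℝ, EP) p p) v =
      (show EP →L[ℝ] G from mfderiv 𝓘(ℝ, EP) 𝓘(ℝ, G) k p) v := by
  have hsymm : (extChartAt 𝓘(ℝ, EP) p).symm (extChartAt 𝓘(ℝ, EP) p p) = p := extChartAt_to_inv p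
  have h := (fderiv_comp_extChartAt_symm p (mem_extChartAt_target p) (by rwa [hsymm])).2 v
  rw [mfderiv_extChartAt_symm_self, hsymm] at h
  exact h

/-- If `X` and `Y` satisfy `dg = Z ∘ dr` and `X` annihilates `r` and `Z` at `p`, then `[X, Y]`
satisfies `dg = Z ∘ dr` at `p`. -/
theorem mfderiv_mlieBracket_eq_of_mfderiv_eq {g : P → G} {r : P → H} {Z : P → H →L[ℝ] G} {p : P}
    {X Y : ∀ x : P, TangentSpace 𝓘(ℝ, EP) x}
    (hg : ContMDiffAt 𝓘(ℝ, EP) 𝓘(ℝ, G) ∞ g p) (hr : ContMDiffAt 𝓘(ℝ, EP) 𝓘(ℝ, H) ∞ r p)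
    (hZ : ContMDiffAt 𝓘(ℝ, EP) 𝓘(ℝ, H →L[ℝ] G) ∞ Z p)
    (hX : MDifferentiableAt 𝓘(ℝ, EP) 𝓘(ℝ, EP).tangent
      (fun x ↦ (⟨x, X x⟩ : TangentBundle 𝓘(ℝ, EP) P)) p)
    (hY : MDifferentiableAt 𝓘(ℝ, EP) 𝓘(ℝ, EP).tangent
      (fun x ↦ (⟨x, Y x⟩ : TangentBundle 𝓘(ℝ, EP) P)) p)
    (hgX : ∀ᶠ x in 𝓝 p, (show G from mfderiv 𝓘(ℝ, EP) 𝓘(ℝ, G) g x (X x)) =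
      Z x (mfderiv 𝓘(ℝ, EP) 𝓘(ℝ, H) r x (X x)))
    (hgY : ∀ᶠ x in 𝓝 p, (show G from mfderiv 𝓘(ℝ, EP) 𝓘(ℝ, G) g x (Y x)) =
      Z x (mfderiv 𝓘(ℝ, EP) 𝓘(ℝ, H) r x (Y x)))
    (hrX : mfderiv 𝓘(ℝ, EP) 𝓘(ℝ, H) r p (X p) = 0)
    (hZX : mfderiv 𝓘(ℝ, EP) 𝓘(ℝ, H →L[ℝ] G) Z p (X p) = 0) :
    (show G from mfderiv 𝓘(ℝ, EP) 𝓘(ℝ, G) g p (VectorField.mlieBracket 𝓘(ℝ, EP) X Y p)) =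
      Z p (mfderiv 𝓘(ℝ, EP) 𝓘(ℝ, H) r p (VectorField.mlieBracket 𝓘(ℝ, EP) X Y p)) := by
  set φ := extChartAt 𝓘(ℝ, EP) p
  have hsymm : φ.symm (φ p) = p := extChartAt_to_inv p
  have htgt : ∀ᶠ x in 𝓝 (φ p), x ∈ φ.target := extChartAt_target_mem_nhds p
  have htend : Filter.Tendsto φ.symm (𝓝 (φ p)) (𝓝 p) := by
    have : ContinuousAt φ.symm (φ p) := continuousAt_extChartAt_symm p
    rwa [ContinuousAt, hsymm] at this
  have hgd : ∀ᶠ x in 𝓝 p, MDifferentiableAt 𝓘(ℝ, EP) 𝓘(ℝ, G) g x :=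
    (((contMDiffAt_iff_contMDiffAt_nhds (n := 1) (by simp)).1 (hg.of_le (by simp)))).mono
      fun x hx ↦ hx.mdifferentiableAt (by simp)
  have hrd : ∀ᶠ x in 𝓝 p, MDifferentiableAt 𝓘(ℝ, EP) 𝓘(ℝ, H) r x :=
    (((contMDiffAt_iff_contMDiffAt_nhds (n := 1) (by simp)).1 (hr.of_le (by simp)))).mono
      fun x hx ↦ hx.mdifferentiableAt (by simp)
  have hrel : ∀ T : ∀ x : P, TangentSpace 𝓘(ℝ, EP) x,
      (∀ᶠ x in 𝓝 p, (show G from mfderiv 𝓘(ℝ, EP) 𝓘(ℝ, G) g x (T x)) =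
        Z x (mfderiv 𝓘(ℝ, EP) 𝓘(ℝ, H) r x (T x))) →
      ∀ᶠ x in 𝓝 (φ p), fderiv ℝ (g ∘ φ.symm) x (chartField p T x) =
        (Z ∘ φ.symm) x (fderiv ℝ (r ∘ φ.symm) x (chartField p T x)) := by
    intro T hT
    filter_upwards [htgt, htend.eventually hT, htend.eventually hgd, htend.eventually hrd]
      with x hx hTx hgx hrx
    rw [(fderiv_comp_extChartAt_symm p hx hgx).2, (fderiv_comp_extChartAt_symm p hx hrx).2,
      mfderiv_symm_chartField p T hx]
    exact hTx
  have hXp : chartField p X (φ p) = X p := by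
    have h1 : (show EP from mfderiv 𝓘(ℝ, EP) 𝓘(ℝ, EP) φ.symm (φ p)
        (chartField (EP := EP) p X (φ p))) =
        chartField p X (φ p) := mfderiv_extChartAt_symm_self p _
    -- `φ.symm (φ p)` equals `p` only propositionally, so the base point is generalized before
    -- substituting.
    have h2 : ∀ x, x = p → (show EP from X x) = X p := by rintro _ rfl; rfl
    exact h1.symm.trans ((mfderiv_symm_chartField p X htgt.self_of_nhds).trans (h2 _ hsymm))
  have hg' := contDiffAt_comp_extChartAt_symm (EP := EP) p hg
  have hr' := contDiffAt_comp_extChartAt_symm (EP := EP) p hr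
  have hZ' := contDiffAt_comp_extChartAt_symm (EP := EP) p hZ
  have htwo : (2 : WithTop ℕ∞) ≤ ∞ := WithTop.coe_le_coe.2 (le_top (a := (2 : ℕ∞)))
  have key := fderiv_lieBracket_eq_of_fderiv_eq (hg'.of_le htwo) (hr'.of_le htwo)
    (hZ'.differentiableAt (by simp)) (differentiableAt_chartField hX)
    (differentiableAt_chartField hY) (hrel X hgX) (hrel Y hgY)
    (by rw [fderiv_comp_extChartAt_symm_self hrd.self_of_nhds, hXp]; exact hrX)
    (by rw [fderiv_comp_extChartAt_symm_self (hZ.mdifferentiableAt (by simp)), hXp]; exact hZX)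
  rw [fderiv_comp_extChartAt_symm_self hgd.self_of_nhds,
    fderiv_comp_extChartAt_symm_self hrd.self_of_nhds, Function.comp_apply, hsymm,
    ← mlieBracket_eq_lieBracket_chartField] at key
  exact key

end Bracket

theorem mfderiv_comp_apply_eq_zero {E E' E'' H H' H'' : Type*}
    [NormedAddCommGroup E] [NormedSpace ℝ E] [NormedAddCommGroup E'] [NormedSpace ℝ E']
    [NormedAddCommGroup E''] [NormedSpace ℝ E''] [TopologicalSpace H] [TopologicalSpace H']
    [TopologicalSpace H''] {I : ModelWithCorners ℝ E H} {I' : ModelWithCorners ℝ E' H'}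
    {I'' : ModelWithCorners ℝ E'' H''} {X X' X'' : Type*} [TopologicalSpace X] [ChartedSpace H X]
    [TopologicalSpace X'] [ChartedSpace H' X'] [TopologicalSpace X''] [ChartedSpace H'' X'']
    {f : X → X'} {g : X' → X''} {x : X} (hg : MDifferentiableAt I' I'' g (f x))
    (hf : MDifferentiableAt I I' f x) {v : TangentSpace I x} (hv : mfderiv I I' f x v = 0) :
    mfderiv I I'' (g ∘ f) x v = 0 := by
  rw [mfderiv_comp x hg hf]
  change mfderiv I' I'' g (f x) (mfderiv I I' f x v) = 0
  rw [hv, map_zero]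

/-! ### Injectivity of the symbol map implies immersion -/

section Immersion

variable {EP : Type*} [NormedAddCommGroup EP] [NormedSpace ℝ EP] [FiniteDimensional ℝ EP]
  {P : Type*} [TopologicalSpace P] [ChartedSpace EP P] [IsManifold 𝓘(ℝ, EP) ∞ P]
  {EM : Type*} [NormedAddCommGroup EM] [NormedSpace ℝ EM] [FiniteDimensional ℝ EM]
  {M : Type*} [TopologicalSpace M] [ChartedSpace EM M] [IsManifold 𝓘(ℝ, EM) ∞ M]
  {EQ : Type*} [NormedAddCommGroup EQ] [NormedSpace ℝ EQ] [FiniteDimensional ℝ EQ]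
  {Q : Type*} [TopologicalSpace Q] [ChartedSpace EQ Q] [IsManifold 𝓘(ℝ, EQ) ∞ Q]
  {F : Type*} [NormedAddCommGroup F] [NormedSpace ℝ F] [FiniteDimensional ℝ F]
  {N : P → Type*} [TopologicalSpace (TotalSpace F N)] [∀ p, AddCommGroup (N p)]
  [∀ p, Module ℝ (N p)] [∀ p, TopologicalSpace (N p)] [∀ p, IsTopologicalAddGroup (N p)]
  [∀ p, ContinuousSMul ℝ (N p)] [FiberBundle F N] [VectorBundle ℝ F N]
  {θ : ∀ p : P, TangentSpace 𝓘(ℝ, EP) p →L[ℝ] N p}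
  {f : P → Q} {τ : C^∞⟮𝓘(ℝ, EQ), Q; 𝓘(ℝ, EM), M⟯}

/-- The trivialization of `TM` is the differential of the chart. This matches the relation `df = ζ ∘
dρ` with the form `dg = Z ∘ dr`, where `g` and `r` are vector-valued functions, required by the
bracket lemma. -/
theorem mfderiv_extChartAt_comp_eq {ρ : P → M} (hρ : ContMDiff 𝓘(ℝ, EP) 𝓘(ℝ, EM) ∞ ρ) {p₀ p : P}
    (hp : ρ p ∈ (trivializationAt EM (TangentSpace 𝓘(ℝ, EM)) (ρ p₀)).baseSet)
    (v : TangentSpace 𝓘(ℝ, EP) p) :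
    mfderiv 𝓘(ℝ, EP) 𝓘(ℝ, EM) (extChartAt 𝓘(ℝ, EM) (ρ p₀) ∘ ρ) p v =
      (trivializationAt EM (TangentSpace 𝓘(ℝ, EM)) (ρ p₀)).continuousLinearMapAt ℝ (ρ p)
        (mfderiv 𝓘(ℝ, EP) 𝓘(ℝ, EM) ρ p v) := by
  have hp' : ρ p ∈ (chartAt EM (ρ p₀)).source := by simpa using hp
  rw [TangentBundle.continuousLinearMapAt_trivializationAt hp',
    mfderiv_extChartAt_comp (by simpa using hp') ((hρ p).mdifferentiableAt (by simp))]
  rfl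

theorem homCoord_apply_mfderiv (hρ : ContMDiff 𝓘(ℝ, EP) 𝓘(ℝ, EM) ∞ (τ ∘ f)) {p₀ p : P}
    (hp : τ (f p) ∈ (trivializationAt EM (TangentSpace 𝓘(ℝ, EM)) (τ (f p₀))).baseSet)
    (ζ : TangentSpace 𝓘(ℝ, EM) (τ (f p)) →L[ℝ] TangentSpace 𝓘(ℝ, EQ) (f p))
    (v : TangentSpace 𝓘(ℝ, EP) p) :
    homCoord τ (f p₀) (f p) ζ
        (mfderiv 𝓘(ℝ, EP) 𝓘(ℝ, EM) (extChartAt 𝓘(ℝ, EM) (τ (f p₀)) ∘ τ ∘ f) p v) =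
      (trivializationAt EQ (TangentSpace 𝓘(ℝ, EQ)) (f p₀)).continuousLinearMapAt ℝ (f p)
        (ζ (mfderiv 𝓘(ℝ, EP) 𝓘(ℝ, EM) (τ ∘ f) p v)) := by
  have h1 := mfderiv_extChartAt_comp_eq hρ (p₀ := p₀) hp v
  have h2 : (trivializationAt EM (TangentSpace 𝓘(ℝ, EM)) (τ (f p₀))).symmL ℝ (τ (f p))
      ((trivializationAt EM (TangentSpace 𝓘(ℝ, EM)) (τ (f p₀))).continuousLinearMapAt ℝ (τ (f p))
        (mfderiv 𝓘(ℝ, EP) 𝓘(ℝ, EM) (τ ∘ f) p v)) = mfderiv 𝓘(ℝ, EP) 𝓘(ℝ, EM) (τ ∘ f) p v :=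
    Trivialization.symmL_continuousLinearMapAt _ hp _
  refine (congrArg (homCoord τ (f p₀) (f p) ζ) h1).trans ?_
  exact congrArg (fun Y ↦ (trivializationAt EQ (TangentSpace 𝓘(ℝ, EQ)) (f p₀)).continuousLinearMapAt
    ℝ (f p) (ζ Y)) h2

/-- The graph of `jetHom` over `ker θ` determines `ker θ`. -/
theorem eq_zero_of_jetHom_mfderiv (hθ : IsPfaffianFibration EM F (τ ∘ f) θ)
    (hsimple : ∀ p, symbolSpace EM (τ ∘ f) θ p = vertical EP EQ f p) {p : P}
    {b : TangentSpace 𝓘(ℝ, EP) p}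
    (hb : mfderiv 𝓘(ℝ, EP) 𝓘(ℝ, EQ) f p b =
      jetHom hθ hsimple p (mfderiv 𝓘(ℝ, EP) 𝓘(ℝ, EM) (τ ∘ f) p b)) : θ p b = 0 := by
  obtain ⟨u, hu, hub⟩ := hθ.exists_vertical p (θ p b)
  have hw : θ p (b - u) = 0 := by rw [map_sub, hub, sub_self]
  have hu' : mfderiv 𝓘(ℝ, EP) 𝓘(ℝ, EM) (τ ∘ f) p u = 0 := hu
  have h1 := jetHom_mfderiv hθ hsimple p hw
  -- Comparison with `hb` leaves `df u = 0`, so `u ∈ 𝔤(θ)` and `θ b = θ u = 0`.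
  rw [map_sub, hu', sub_zero, map_sub, ← hb, eq_comm, sub_eq_self] at h1
  have h2 : u ∈ symbolSpace EM (τ ∘ f) θ p := by rw [hsimple]; exact h1
  rw [← hub]
  exact h2.2

/-- Sections of `ker θ` satisfy `dg = Z ∘ dr`, where `g` and `r` are `f` and `τ ∘ f` in charts and
`Z` is `ζ` in coordinates. As `u` annihilates `r` and `Z`, the bracket satisfies the same relation
at `p`, which puts it in `ker θ`. The argument works for whichever extensions the definition of
`curvature` chooses. -/
theorem curvature_eq_zero (hf : IsFibration EP EQ f) (hθ : IsPfaffianFibration EM F (τ ∘ f) θ)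
    (hsimple : ∀ p, symbolSpace EM (τ ∘ f) θ p = vertical EP EQ f p) (p : P) (u w : kernel θ p)
    (hu : mfderiv 𝓘(ℝ, EP) 𝓘(ℝ, EM) (τ ∘ f) p u = 0)
    (hZu : mfderiv 𝓘(ℝ, EP) 𝓘(ℝ, EM →L[ℝ] EQ)
      (fun x ↦ homCoord τ (f p) (f x) (jetHom hθ hsimple x)) p u = 0) :
    curvature θ p u w = 0 := by
  have := FiniteDimensional.complete ℝ EP
  unfold curvature
  split_ifs with h
  -- Without extensions the curvature has the default value `0`.
  swap
  · rfl
  obtain ⟨hX, -, U, hpU, hXU, hYU⟩ := h.choose_spec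
  set X := h.choose.1
  set Y := h.choose.2
  have hτf := hθ.fibration.contMDiff
  have hQ := eventually_mem_baseSet (EM := EQ) hf.contMDiff.continuous p
  have hM := eventually_mem_baseSet (EM := EM) hτf.continuous p
  have hrel : ∀ T : ∀ x : P, TangentSpace 𝓘(ℝ, EP) x, (∀ x ∈ U, T x ∈ kernel θ x) →
      ∀ᶠ x in 𝓝 p, (show EQ from
        mfderiv 𝓘(ℝ, EP) 𝓘(ℝ, EQ) (extChartAt 𝓘(ℝ, EQ) (f p) ∘ f) x (T x)) =
        homCoord τ (f p) (f x) (jetHom hθ hsimple x)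
          (mfderiv 𝓘(ℝ, EP) 𝓘(ℝ, EM) (extChartAt 𝓘(ℝ, EM) (τ (f p)) ∘ τ ∘ f) x (T x)) := by
    intro T hT
    filter_upwards [hXU.isOpen.mem_nhds hpU, hQ, hM] with x hxU hxQ hxM
    rw [homCoord_apply_mfderiv hτf hxM, jetHom_mfderiv hθ hsimple x (hT x hxU)]
    exact mfderiv_extChartAt_comp_eq hf.contMDiff hxQ (T x)
  have hru : mfderiv 𝓘(ℝ, EP) 𝓘(ℝ, EM) (extChartAt 𝓘(ℝ, EM) (τ (f p)) ∘ τ ∘ f) p (X p) = 0 := by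
    rw [hX]
    refine (mfderiv_extChartAt_comp_eq hτf hM.self_of_nhds _).trans ?_
    exact (congrArg _ hu).trans (map_zero _)
  have key := mfderiv_mlieBracket_eq_of_mfderiv_eq
    (contMDiffAt_extChartAt_comp (mem_extChartAt_source (f p)) (hf.contMDiff p))
    (contMDiffAt_extChartAt_comp (mem_extChartAt_source (τ (f p))) (hτf p))
    (contMDiffAt_homCoord_jetHom hf hθ hsimple p)
    ((hXU.contMDiffOn.contMDiffAt (hXU.isOpen.mem_nhds hpU)).mdifferentiableAt (by simp))
    ((hYU.contMDiffOn.contMDiffAt (hXU.isOpen.mem_nhds hpU)).mdifferentiableAt (by simp))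
    (hrel X hXU.mem) (hrel Y hYU.mem) hru (by rw [hX]; exact hZu)
  rw [homCoord_apply_mfderiv hτf hM.self_of_nhds] at key
  refine eq_zero_of_jetHom_mfderiv hθ hsimple ?_
  have key' := (mfderiv_extChartAt_comp_eq hf.contMDiff hQ.self_of_nhds
    (VectorField.mlieBracket 𝓘(ℝ, EP) X Y p)).symm.trans key
  rw [← Trivialization.coe_continuousLinearEquivAt_eq _ hQ.self_of_nhds] at key'
  exact ((trivializationAt EQ (TangentSpace 𝓘(ℝ, EQ)) (f p)).continuousLinearEquivAt ℝ (f p)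
    hQ.self_of_nhds).injective key'

theorem contMDiffAt_trivializationAt_snd (z : HomBundle τ) :
    ContMDiffAt (jetModel EM EQ) 𝓘(ℝ, EM →L[ℝ] EQ) ∞
      (fun y : HomBundle τ ↦ ContinuousLinearMap.inCoordinates EM
        (τ *ᵖ (fun x : M ↦ TangentSpace 𝓘(ℝ, EM) x)) EQ (TangentSpace 𝓘(ℝ, EQ))
        z.proj y.proj z.proj y.proj y.snd) z :=
  ((contMDiffAt_hom_bundle (fun y : HomBundle τ ↦ y)).1 contMDiffAt_id).2

/-- Near `p` the coordinate expression of `ζ` is the fibre coordinate of `Hom(τ^*TM, TQ)` composed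
with `i`, so the chain rule applies. -/
theorem mfderiv_homCoord_of_differential_eq_zero (hf : IsFibration EP EQ f)
    (hθ : IsPfaffianFibration EM F (τ ∘ f) θ)
    (hsimple : ∀ p, symbolSpace EM (τ ∘ f) θ p = vertical EP EQ f p) {p : P}
    {v : TangentSpace 𝓘(ℝ, EP) p} (hv : Jet1.differential (jetMap hf hθ hsimple) p v = 0) :
    mfderiv 𝓘(ℝ, EP) 𝓘(ℝ, EM →L[ℝ] EQ)
      (fun x ↦ homCoord τ (f p) (f x) (jetHom hθ hsimple x)) p v = 0 := by
  have h := mfderiv_comp_apply_eq_zero (f := fun x ↦ (jetMap hf hθ hsimple x).1)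
    ((contMDiffAt_trivializationAt_snd (jetMap hf hθ hsimple p).1).mdifferentiableAt (by simp))
    ((contMDiffInto_jetMap hf hθ hsimple p).mdifferentiableAt (by simp)) hv
  have heq : (fun x ↦ homCoord τ (f p) (f x) (jetHom hθ hsimple x)) =ᶠ[𝓝 p]
      (fun y : HomBundle τ ↦ ContinuousLinearMap.inCoordinates EM
        (τ *ᵖ (fun x : M ↦ TangentSpace 𝓘(ℝ, EM) x)) EQ (TangentSpace 𝓘(ℝ, EQ))
        (jetMap hf hθ hsimple p).1.proj y.proj (jetMap hf hθ hsimple p).1.proj y.proj y.snd) ∘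
        fun x ↦ (jetMap hf hθ hsimple x).1 := by
    filter_upwards [eventually_mem_baseSet (EM := EM) hθ.fibration.contMDiff.continuous p]
      with x hx
    exact (inCoordinates_pullback hx _).symm
  rw [heq.mfderiv_eq]
  exact h

/-- A vector killed by `di` is killed by `df = d(pr ∘ i)`, hence lies in `𝔤(θ)`; its curvature with
all of `ker θ` then vanishes, so its symbol does. -/
theorem isImmersionInto_jetMap (hf : IsFibration EP EQ f)
    (hθ : IsPfaffianFibration EM F (τ ∘ f) θ)
    (hsimple : ∀ p, symbolSpace EM (τ ∘ f) θ p = vertical EP EQ f p)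
    (hinj : ∀ p, Function.Injective (symbolMap hθ p)) :
    Jet1.IsImmersionInto EP (jetMap hf hθ hsimple) := by
  refine ⟨contMDiffInto_jetMap hf hθ hsimple, fun p ↦ ?_⟩
  refine (LinearMap.ker_eq_bot (f := (Jet1.differential (jetMap hf hθ hsimple) p).toLinearMap)).1
    (LinearMap.ker_eq_bot'.2 fun v hv ↦ ?_)
  have hproj : MDifferentiableAt (jetModel EM EQ) 𝓘(ℝ, EQ) (fun y : HomBundle τ ↦ y.proj)
      (jetMap hf hθ hsimple p).1 :=
    ((contMDiff_proj (IB := 𝓘(ℝ, EQ)) (n := ∞) (F := EM →L[ℝ] EQ) (fun q : Q ↦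
      (τ *ᵖ (fun x : M ↦ TangentSpace 𝓘(ℝ, EM) x)) q →L[ℝ] TangentSpace 𝓘(ℝ, EQ) q)) _
      ).mdifferentiableAt (by simp)
  have hfv : mfderiv 𝓘(ℝ, EP) 𝓘(ℝ, EQ) f p v = 0 :=
    mfderiv_comp_apply_eq_zero (f := fun x ↦ (jetMap hf hθ hsimple x).1) hproj
      ((contMDiffInto_jetMap hf hθ hsimple p).mdifferentiableAt (by simp)) hv
  have hvs : v ∈ symbolSpace EM (τ ∘ f) θ p := by rw [hsimple]; exact hfv
  have hzero : ∀ (u : symbolSpace EM (τ ∘ f) θ p),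
      Jet1.differential (jetMap hf hθ hsimple) p (u : TangentSpace 𝓘(ℝ, EP) p) = 0 →
        symbolMap hθ p u = 0 := fun u hu ↦ funext fun Y ↦
    curvature_eq_zero hf hθ hsimple p _ _ u.2.1
      (mfderiv_homCoord_of_differential_eq_zero hf hθ hsimple hu)
  -- `symbolMap` is a bare function, so its value at `0` is computed by the same argument rather
  -- than by linearity.
  have h := @hinj p ⟨v, hvs⟩ 0 ((hzero _ hv).trans (hzero 0
    (Jet1.differential (jetMap hf hθ hsimple) p).map_zero).symm)
  exact congrArg Subtype.val h

end Immersion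

end Pfaffian

end

/-! ### The main theorem -/

theorem mainTheorem10
    {EP : Type*} [NormedAddCommGroup EP] [NormedSpace ℝ EP] [FiniteDimensional ℝ EP]
    {P : Type*} [TopologicalSpace P] [ChartedSpace EP P] [IsManifold 𝓘(ℝ, EP) ∞ P]
    {EM : Type*} [NormedAddCommGroup EM] [NormedSpace ℝ EM] [FiniteDimensional ℝ EM]
    {M : Type*} [TopologicalSpace M] [ChartedSpace EM M] [IsManifold 𝓘(ℝ, EM) ∞ M]
    {EQ : Type*} [NormedAddCommGroup EQ] [NormedSpace ℝ EQ] [FiniteDimensional ℝ EQ]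
    {Q : Type*} [TopologicalSpace Q] [ChartedSpace EQ Q] [IsManifold 𝓘(ℝ, EQ) ∞ Q]
    {F : Type*} [NormedAddCommGroup F] [NormedSpace ℝ F] [FiniteDimensional ℝ F]
    {N : P → Type*} [TopologicalSpace (TotalSpace F N)] [∀ p, AddCommGroup (N p)]
    [∀ p, Module ℝ (N p)] [∀ p, TopologicalSpace (N p)] [∀ p, IsTopologicalAddGroup (N p)]
    [∀ p, ContinuousSMul ℝ (N p)] [FiberBundle F N] [VectorBundle ℝ F N]
    [ContMDiffVectorBundle ∞ F N 𝓘(ℝ, EP)]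
    (ρ : P → M) (θ : ∀ p : P, TangentSpace 𝓘(ℝ, EP) p →L[ℝ] N p)
    (hθ : Pfaffian.IsPfaffianFibration EM F ρ θ)
    (f : P → Q) (hf : Pfaffian.IsFibration EP EQ f)
    (hconn : ∀ q : Q, IsConnected (f ⁻¹' {q}))
    (hsimple : ∀ p, Pfaffian.symbolSpace EM ρ θ p = Pfaffian.vertical EP EQ f p) :
    ∃ τ : C^∞⟮𝓘(ℝ, EQ), Q; 𝓘(ℝ, EM), M⟯,
      Pfaffian.IsFibration EQ EM τ ∧ (∀ p, τ (f p) = ρ p) ∧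
      ∃ (Φ : Pfaffian.VerticalIso EP F N f τ) (i : P → Pfaffian.Jet1 τ),
        Pfaffian.IsCartanBundleMap Φ θ i ∧
        (∀ j : P → Pfaffian.Jet1 τ, Pfaffian.IsCartanBundleMap Φ θ j → j = i) ∧
        ((∀ p, Function.Injective (Pfaffian.symbolMap hθ p)) →
          Pfaffian.Jet1.IsImmersionInto EP i) := by
  obtain ⟨τ, hτ⟩ := Pfaffian.exists_factorization hf hconn hθ.fibration.contMDiff
    fun p ↦ (hsimple p).symm.trans_le inf_le_left
  -- Replacing `ρ` by `τ ∘ f` makes `T_{ρ p} M` and `T_{τ (f p)} M` the same type.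
  obtain rfl : ρ = τ ∘ f := funext fun p ↦ (hτ p).symm
  have hi := Pfaffian.isCartanBundleMap_jetMap hf hθ hsimple
  exact ⟨τ, hf.of_comp hθ.fibration, fun _ ↦ rfl, Pfaffian.verticalIso EP hf hθ hsimple,
    Pfaffian.jetMap hf hθ hsimple, hi, fun j hj ↦ hj.unique hθ hi,
    Pfaffian.isImmersionInto_jetMap hf hθ hsimple⟩
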